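/- Let $G$ be a cactus of order $n$ with exactly $r$ cycles, i.e. a finite simple connected graph all of whose blocks are edges or cycles (the one-vertex graph is allowed). Let $D$ be an orientation of $G$, obtained by replacing each edge $uv$ of $G$ by exactly one of the arcs $u\to v$, $v\to u$. Let $d^+_u$ and $d^-_u$ be the out-degree and in-degree of $u$ in $D$, and let $a\ge 1$ be real. Then the zeroth-order general Randić index $$R^0_{a+1}(D)=\frac12\sum_{u\to v}\left[(d^+_u)^a+(d^-_v)^a\right],$$ where the sum runs over all arcs $u\to v$ of $D$, satisfies $$R^0_{a+1}(D)\le\frac12\left[(n-1)^{a+1}+n-1+2r\cdot 2^a\right].$$ Let $G^0(n,r)$ be the graph of order $n$ that consists of $r$ triangles and $n-2r-1$ pendent edges, all sharing one common vertex. Up to isomorphism it has exactly one orientation $G^{(1)}(n,r)$ in which the common vertex is a source (in-degree $0$) and exactly one orientation $G^{(2)}(n,r)$ in which it is a sink (out-degree $0$). Equality holds in the bound if and only if $D$ is isomorphic to $G^{(1)}(n,r)$ or $G^{(2)}(n,r)$, or $a=1$, $(n,r)=(4,1)$ and $D$ is isomorphic to a sink-source orientation of the $4$-cycle $C_4$ (an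 orientation in which every vertex is a source or a sink). -/

import Mathlib

namespace CactusRandic

/-- A nonseparable subgraph: connected and without a cut vertex. -/
def IsNonseparable {V : Type*} {G : SimpleGraph V} (H : G.Subgraph) : Prop :=
  H.Connected ∧ ∀ v : V, (H.deleteVerts {v}).Preconnected

/-- A block of `G`: a maximal connected subgraph without a cut vertex. -/
def IsBlock {V : Type*} {G : SimpleGraph V} (H : G.Subgraph) : Prop :=
  Maximal IsNonseparable H

/-- `H` consists of a single edge of `G` and its two ends. -/
def IsEdgeSubgraph {V : Type*} {G : SimpleGraph V} (H : G.Subgraph) : Prop :=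
  ∃ (u v : V) (h : G.Adj u v), H = G.subgraphOfAdj h

/-- `H` is a cycle of `G` (as a subgraph, without base point and direction). -/
def IsCycleSubgraph {V : Type*} {G : SimpleGraph V} (H : G.Subgraph) : Prop :=
  ∃ (u : V) (p : G.Walk u u), p.IsCycle ∧ H = p.toSubgraph

/-- A cactus: a connected graph whose blocks are edges or cycles. (In a connected graph a block
with only one vertex occurs only if the graph itself has just one vertex; the restriction to
blocks with at least two vertices lets the one-vertex graph count as a cactus.) -/
def IsCactus {V : Type*} (G : SimpleGraph V) : Prop :=
  G.Connected ∧
    ∀ H : G.Subgraph, IsBlock H → H.verts.Nontrivial → IsEdgeSubgraph H ∨ IsCycleSubgraph H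

/-- The number of cycles of `G`. -/
noncomputable def numCycles {V : Type*} (G : SimpleGraph V) : ℕ :=
  {H : G.Subgraph | IsCycleSubgraph H}.ncard

/-- `D` is an orientation of `G`: each edge `uv` of `G` is replaced by exactly one of the two
arcs `uv`, `vu`, and `D` has no other arcs. -/
def IsOrientation {V : Type*} (G : SimpleGraph V) (D : Digraph V) : Prop :=
  (∀ u v : V, G.Adj u v ↔ D.Adj u v ∨ D.Adj v u) ∧ ∀ u v : V, ¬ (D.Adj u v ∧ D.Adj v u)

/-- The out-degree of a vertex. -/
noncomputable def outDeg {V : Type*} (D : Digraph V) (v : V) : ℕ := {w | D.Adj v w}.ncard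

/-- The in-degree of a vertex. -/
noncomputable def inDeg {V : Type*} (D : Digraph V) (v : V) : ℕ := {w | D.Adj w v}.ncard

/-- A sink-source orientation: every vertex is a sink or a source. -/
def IsSinkSource {V : Type*} (D : Digraph V) : Prop :=
  ∀ w : V, outDeg D w = 0 ∨ inDeg D w = 0

open Classical in
/-- The zeroth-order general Randić index `R⁰_b(D)`, that is, half the sum of
`(d⁺_u)^(b-1) + (d⁻_v)^(b-1)` over all arcs `uv` of `D`. -/
noncomputable def randic {V : Type*} [Fintype V] (b : ℝ) (D : Digraph V) : ℝ :=
  (1 / 2) * ∑ e : V × V with D.Adj e.1 e.2,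
    ((outDeg D e.1 : ℝ) ^ (b - 1) + (inDeg D e.2 : ℝ) ^ (b - 1))

/-- Isomorphism of digraphs. -/
def DigraphIso {V W : Type*} (D : Digraph V) (E : Digraph W) : Prop :=
  Nonempty (D.Adj ≃r E.Adj)

/-- The graph `G⁰(n, r)` (meant for `2 * r + 1 ≤ n`): the vertex `0` is adjacent to all the other
vertices, and the further edges are the `r` edges joining `2 * i - 1` and `2 * i`, `1 ≤ i ≤ r`.
So it consists of `r` triangles and `n - 2 * r - 1` pendent edges that share the vertex `0`. -/
def graphZero (n r : ℕ) : SimpleGraph (Fin n) :=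
  SimpleGraph.fromRel fun u v =>
    u.val = 0 ∨ ∃ i : ℕ, 1 ≤ i ∧ i ≤ r ∧ u.val + 1 = 2 * i ∧ v.val = 2 * i

/-- The orientation of `G⁰(n, r)` along increasing labels; the common vertex `0` is a source. -/
def digraphOne (n r : ℕ) : Digraph (Fin n) where
  Adj u v := (graphZero n r).Adj u v ∧ u < v

/-- The orientation of `G⁰(n, r)` along decreasing labels; the common vertex `0` is a sink. -/
def digraphTwo (n r : ℕ) : Digraph (Fin n) where
  Adj u v := (graphZero n r).Adj u v ∧ v < u

/-- Membership, up to isomorphism, in the family of extremal digraphs: the two orientations of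
`G⁰(n, r)` above and, if `a = 1` and `(n, r) = (4, 1)`, also the sink-source orientations of the
cycle with four vertices. -/
def IsExtremal {V : Type*} (a : ℝ) (n r : ℕ) (D : Digraph V) : Prop :=
  DigraphIso D (digraphOne n r) ∨ DigraphIso D (digraphTwo n r) ∨
    (a = 1 ∧ n = 4 ∧ r = 1 ∧ ∃ E : Digraph (Fin 4),
      IsOrientation (SimpleGraph.cycleGraph 4) E ∧ IsSinkSource E ∧ DigraphIso D E)

end CactusRandic

namespace CactusRandic

/-! Grouping the arcs by tail and by head turns the index into half the sum of `x ^ (a + 1)` over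
all out-degrees and in-degrees `x`. Write `x ^ (a + 1) = x + (2 ^ (a + 1) - 2) * x.choose 2 +
powExcess a x`. The bound is what results from estimating the three sums separately. The linear one
is fixed: it is twice the number of edges, which is `n - 1 + r` in a cactus
(`IsCactus.ncard_edgeSet`).

The binomial sum counts cherries, that is, pairs of out-neighbours or of in-neighbours of one
vertex. There are `(n - 1).choose 2 - r` nonadjacent pairs, and one cherry is allowed for each.
Further cherries come from short cycles: a cherry with adjacent ends lies in a triangle, which holds
at most two, and two cherries over one nonadjacent pair form a 4-cycle, which accounts for an excess
of at most two. Hence the sum is at most `(n - 1).choose 2 + r` (`IsOrientation.sum_cherries_le`,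
`IsCactus.sum_choose_le`).

The function `powExcess a` vanishes at 0, 1, 2, and its shift by two is superadditive and monotone
because the second difference of `x ^ (a + 1)` increases with `x`. As the degrees of a cactus exceed
two by at most `n - 3` in total, the excess sum is at most `powExcess a (n - 1)`
(`IsCactus.sum_powExcess_le`).

Equality needs both estimates to be sharp. Sharpness of the first gives every nonadjacent pair a
cherry and every cycle length 3 or 4. If some vertex is adjacent to all others, there is a universal
source or sink, and the edges avoiding it form a matching. Otherwise all degrees are at most two and
only the 4-cycle remains; there the second estimate requires `powExcess a 3 = 0`, hence `a = 1`. -/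

/-! ### Cycles in the blocks of a cactus -/

theorem _root_.SimpleGraph.Walk.IsCycle.isNonseparable_toSubgraph {V : Type*} {G : SimpleGraph V}
    {u : V} {p : G.Walk u u} (hp : p.IsCycle) : IsNonseparable p.toSubgraph := by
  classical
  refine ⟨p.toSubgraph_connected, fun v => ?_⟩
  by_cases hv : v ∈ p.support
  -- Start the cycle at `v` and strip its first and last edges: the path `s` that remains avoids `v`
  -- and visits all other vertices.
  · obtain ⟨q, hq, hqp⟩ : ∃ q : G.Walk v v, q.IsCycle ∧ q.toSubgraph = p.toSubgraph :=
      ⟨p.rotate v hv, hp.rotate hv, p.toSubgraph_rotate hv⟩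
    rw [← hqp]
    cases q with
    | nil => exact absurd hq SimpleGraph.Walk.not_isCycle_nil
    | @cons _ w _ h q =>
      rw [SimpleGraph.Walk.cons_isCycle_iff] at hq
      have hr := hq.1.reverse
      have hrs : q.reverse.toSubgraph = q.toSubgraph := q.toSubgraph_reverse
      rw [SimpleGraph.Walk.toSubgraph, ← hrs]
      generalize q.reverse = s at hr
      cases s with
      | nil => exact absurd h (G.loopless.irrefl _)
      | @cons _ x _ h' s =>
        rw [SimpleGraph.Walk.cons_isPath_iff] at hr
        refine (SimpleGraph.Subgraph.Connected.mono (H := s.toSubgraph) ?_ ?_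
          s.toSubgraph_connected).preconnected
        · refine ⟨fun y hy => ?_, fun y z hyz => ?_⟩
          · have hy' : y ∈ s.support := (s.mem_verts_toSubgraph).1 hy
            refine ⟨Or.inr (Or.inr hy), ?_⟩
            rintro rfl
            exact hr.2 hy'
          · rw [SimpleGraph.Subgraph.deleteVerts_adj]
            have h1 : y ∈ s.support := (s.mem_verts_toSubgraph).1 hyz.fst_mem
            have h2 : z ∈ s.support := (s.mem_verts_toSubgraph).1 hyz.snd_mem
            refine ⟨Or.inr (Or.inr hyz.fst_mem), ?_, Or.inr (Or.inr hyz.snd_mem), ?_,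
              Or.inr (Or.inr hyz)⟩
            · rintro rfl
              exact hr.2 h1
            · rintro rfl
              exact hr.2 h2
        · ext y
          have hw : w ∈ s.support := s.end_mem_support
          have hx : x ∈ s.support := s.start_mem_support
          simp only [SimpleGraph.Subgraph.deleteVerts_verts, SimpleGraph.Walk.toSubgraph,
            SimpleGraph.Subgraph.verts_sup, SimpleGraph.subgraphOfAdj_verts, Set.mem_sdiff,
            Set.mem_union, Set.mem_insert_iff, Set.mem_singleton_iff,
            SimpleGraph.Walk.mem_verts_toSubgraph]
          constructor
          · intro hy
            refine ⟨Or.inr (Or.inr hy), ?_⟩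
            rintro rfl
            exact hr.2 hy
          · rintro ⟨(rfl | rfl) | (rfl | rfl) | hy, hne⟩
            · exact absurd rfl hne
            · exact hw
            · exact absurd rfl hne
            · exact hx
            · exact hy
  · have : p.toSubgraph.deleteVerts {v} = p.toSubgraph := by
      rw [← SimpleGraph.Subgraph.deleteVerts_inter_verts_left_eq,
        Set.inter_singleton_eq_empty.2, SimpleGraph.Subgraph.deleteVerts_empty]
      rwa [SimpleGraph.Walk.mem_verts_toSubgraph]
    rw [this]
    exact p.toSubgraph_connected.preconnected

/-- Deleting one vertex destroys at most one of the two shared vertices, so the two remainders still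
meet. -/
theorem IsNonseparable.sup {V : Type*} {G : SimpleGraph V} {H K : G.Subgraph}
    (hH : IsNonseparable H) (hK : IsNonseparable K) {x y : V} (hxy : x ≠ y)
    (hxH : x ∈ H.verts) (hxK : x ∈ K.verts) (hyH : y ∈ H.verts) (hyK : y ∈ K.verts) :
    IsNonseparable (H ⊔ K) := by
  refine ⟨SimpleGraph.Subgraph.connected_sup hH.1.preconnected hK.1.preconnected
    ⟨x, hxH, hxK⟩, fun v => ?_⟩
  have key : (H ⊔ K).deleteVerts {v} = H.deleteVerts {v} ⊔ K.deleteVerts {v} := by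
    ext a b
    · simp only [SimpleGraph.Subgraph.deleteVerts_verts, SimpleGraph.Subgraph.verts_sup,
        Set.mem_sdiff, Set.mem_union]
      tauto
    · simp only [SimpleGraph.Subgraph.deleteVerts_adj, SimpleGraph.Subgraph.sup_adj,
        SimpleGraph.Subgraph.verts_sup, Set.mem_union]
      constructor
      · rintro ⟨-, ha, -, hb, h | h⟩
        · exact Or.inl ⟨h.fst_mem, ha, h.snd_mem, hb, h⟩
        · exact Or.inr ⟨h.fst_mem, ha, h.snd_mem, hb, h⟩
      · tauto
  rw [key]
  refine (SimpleGraph.Subgraph.connected_sup (hH.2 v) (hK.2 v) ?_).preconnected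
  rcases eq_or_ne x v with rfl | hxv
  · exact ⟨y, ⟨hyH, hxy.symm⟩, ⟨hyK, hxy.symm⟩⟩
  · exact ⟨x, ⟨hxH, hxv⟩, ⟨hxK, hxv⟩⟩

theorem _root_.SimpleGraph.Connected.mem_of_adj_closed {V : Type*} {G : SimpleGraph V}
    (hG : G.Connected) {S : Set V} {v : V} (hv : v ∈ S)
    (hS : ∀ x ∈ S, ∀ y, G.Adj x y → y ∈ S) (w : V) : w ∈ S := by
  obtain ⟨p⟩ := hG.preconnected v w
  induction p with
  | nil => exact hv
  | cons h p ih => exact ih (hS _ hv _ h)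

theorem IsCycleSubgraph.ncard_neighborSet {V : Type*} {G : SimpleGraph V} {C : G.Subgraph}
    (hC : IsCycleSubgraph C) {v : V} (hv : v ∈ C.verts) : (C.neighborSet v).ncard = 2 := by
  obtain ⟨u, p, hp, rfl⟩ := hC
  exact hp.ncard_neighborSet_toSubgraph_eq_two ((p.mem_verts_toSubgraph).1 hv)

theorem IsCycleSubgraph.connected {V : Type*} {G : SimpleGraph V} {C : G.Subgraph}
    (hC : IsCycleSubgraph C) : C.Connected := by
  obtain ⟨u, p, hp, rfl⟩ := hC
  exact p.toSubgraph_connected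

theorem IsCycleSubgraph.isNonseparable {V : Type*} {G : SimpleGraph V} {C : G.Subgraph}
    (hC : IsCycleSubgraph C) : IsNonseparable C := by
  obtain ⟨u, p, hp, rfl⟩ := hC
  exact hp.isNonseparable_toSubgraph

/-- Both subgraphs are 2-regular, so they have the same neighbourhoods on `C`; then the vertices of
`C` are closed under adjacency in the connected `K`. -/
theorem IsCycleSubgraph.eq_of_le {V : Type*} {G : SimpleGraph V} {C K : G.Subgraph}
    (hC : IsCycleSubgraph C) (hK : IsCycleSubgraph K) (h : C ≤ K) : C = K := by
  have hn : ∀ v ∈ C.verts, C.neighborSet v = K.neighborSet v := by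
    intro v hv
    refine Set.eq_of_subset_of_ncard_le (fun w hw => h.2 hw) ?_ ?_
    · rw [hC.ncard_neighborSet hv, hK.ncard_neighborSet (h.1 hv)]
    · refine Set.finite_of_ncard_ne_zero ?_
      rw [hK.ncard_neighborSet (h.1 hv)]
      decide
  have hv : ∀ v ∈ K.verts, v ∈ C.verts := by
    obtain ⟨x, hx⟩ := hC.connected.nonempty
    intro v hv
    refine hK.connected.coe.mem_of_adj_closed (S := {y | y.1 ∈ C.verts}) (v := ⟨x, h.1 hx⟩) hx
      ?_ ⟨v, hv⟩
    intro a ha b hab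
    have : b.1 ∈ C.neighborSet a := by
      rw [hn a ha]
      exact hab
    exact SimpleGraph.Subgraph.Adj.snd_mem this
  refine le_antisymm h ⟨hv, fun a b hab => ?_⟩
  have : b ∈ C.neighborSet a := by
    rw [hn a (hv a hab.fst_mem)]
    exact hab
  exact this

/-- Two cycles of a cactus that share two vertices coincide. -/
theorem IsCactus.cycle_eq {V : Type*} [Finite V] {G : SimpleGraph V} (hG : IsCactus G)
    {C K : G.Subgraph} (hC : IsCycleSubgraph C) (hK : IsCycleSubgraph K) {x y : V} (hxy : x ≠ y)
    (hxC : x ∈ C.verts) (hxK : x ∈ K.verts) (hyC : y ∈ C.verts) (hyK : y ∈ K.verts) : C = K := by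
  -- The union is nonseparable, hence inside a block `B`. A single edge cannot contain a vertex of
  -- degree two, and a cycle contains no cycle but itself.
  obtain ⟨B, hle, hB⟩ := Finite.exists_le_maximal
    (hC.isNonseparable.sup hK.isNonseparable hxy hxC hxK hyC hyK)
  have hCB : C ≤ B := le_sup_left.trans hle
  have hKB : K ≤ B := le_sup_right.trans hle
  rcases hG.2 B hB ⟨x, hCB.1 hxC, y, hCB.1 hyC, hxy⟩ with ⟨u, v, h, rfl⟩ | hBc
  · exfalso
    have h2 := hC.ncard_neighborSet hxC
    obtain ⟨a, b, hab, hs⟩ := Set.ncard_eq_two.1 h2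
    have ha : C.Adj x a := by
      change a ∈ C.neighborSet x
      simp [hs]
    have hb : C.Adj x b := by
      change b ∈ C.neighborSet x
      simp [hs]
    have ha' := hCB.2 ha
    have hb' := hCB.2 hb
    simp only [SimpleGraph.subgraphOfAdj_adj, Sym2.eq_iff] at ha' hb'
    grind
  · exact (hC.eq_of_le hBc hCB).trans (hK.eq_of_le hBc hKB).symm

theorem IsCycleSubgraph.three_le_ncard_edgeSet {V : Type*} {G : SimpleGraph V} {C : G.Subgraph}
    (hC : IsCycleSubgraph C) : 3 ≤ C.edgeSet.ncard := by
  classical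
  obtain ⟨u, p, hp, rfl⟩ := hC
  have h : p.toSubgraph.edgeSet = (p.edges.toFinset : Set (Sym2 V)) := by
    ext e
    simp
  rw [h, Set.ncard_coe_finset, List.toFinset_card_of_nodup hp.isTrail.edges_nodup,
    SimpleGraph.Walk.length_edges]
  exact hp.three_le_length

theorem IsCactus.cycle_eq_of_mem_edgeSet {V : Type*} [Finite V] {G : SimpleGraph V}
    (hG : IsCactus G) {C K : G.Subgraph} (hC : IsCycleSubgraph C) (hK : IsCycleSubgraph K)
    {e : Sym2 V} (heC : e ∈ C.edgeSet) (heK : e ∈ K.edgeSet) : C = K := by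
  induction e with
  | _ x y =>
    rw [SimpleGraph.Subgraph.mem_edgeSet] at heC heK
    exact hG.cycle_eq hC hK heC.ne heC.fst_mem heK.fst_mem heC.snd_mem heK.snd_mem

/-! ### Edge counts and degrees in a cactus -/

/-- Deleting one edge from each cycle leaves a spanning tree; the deleted edges are distinct since
cycles share no edge. -/
theorem IsCactus.ncard_edgeSet {V : Type*} [Fintype V] {G : SimpleGraph V} (hG : IsCactus G) :
    G.edgeSet.ncard + 1 = Fintype.card V + numCycles G := by
  classical
  have := hG.1.nonempty
  have hne : ∀ C : G.Subgraph, IsCycleSubgraph C → ∃ e, e ∈ C.edgeSet := by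
    intro C hC
    apply Set.nonempty_of_ncard_ne_zero
    have := hC.three_le_ncard_edgeSet
    omega
  obtain ⟨v₀⟩ := this
  have : Nonempty (Sym2 V) := ⟨s(v₀, v₀)⟩
  choose! e he using hne
  set E : Set (Sym2 V) := e '' {C : G.Subgraph | IsCycleSubgraph C} with hE
  set T := G.deleteEdges E with hT
  have hconn : T.Connected := by
    have hadj : ∀ x y, G.Adj x y → T.Reachable x y := by
      intro x y hxy
      by_cases hm : s(x, y) ∈ E
      · obtain ⟨C, hC, hCe⟩ := hm
        have hC' : IsCycleSubgraph C := hC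
        obtain ⟨u, p, hp, hpC⟩ := hC'
        have hmem : ∀ f ∈ p.edges, f ∈ C.spanningCoe.edgeSet := by
          intro f hf
          rw [SimpleGraph.Subgraph.edgeSet_spanningCoe, hpC]
          exact (p.mem_edges_toSubgraph).2 hf
        have hr := (SimpleGraph.adj_and_reachable_delete_edges_iff_exists_cycle
          (G := C.spanningCoe) (v := x) (w := y)).2 ⟨u, p.transfer _ hmem, hp.transfer hmem, by
            rw [SimpleGraph.Walk.edges_transfer, ← SimpleGraph.Walk.mem_edges_toSubgraph, ← hpC,
              ← hCe]
            exact he C hC⟩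
        -- The other edges of `C` survive in `T`: one chosen for a cycle `K` would force `C = K`.
        refine hr.2.mono ?_
        intro a b hab
        rw [SimpleGraph.deleteEdges_adj] at hab ⊢
        refine ⟨C.adj_sub hab.1, ?_⟩
        rintro ⟨K, hK, hKe⟩
        have h1 := he K hK
        rw [hKe] at h1
        have : C = K := hG.cycle_eq_of_mem_edgeSet hC hK (e := s(a, b)) hab.1 h1
        subst this
        exact hab.2 (by rw [← hKe, ← hCe]; rfl)
      · exact SimpleGraph.Adj.reachable ((SimpleGraph.deleteEdges_adj).2 ⟨hxy, hm⟩)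
    have : Nonempty V := ⟨v₀⟩
    refine ⟨fun x y => ?_⟩
    obtain ⟨p⟩ := hG.1.preconnected x y
    induction p with
    | nil => rfl
    | cons h p ih => exact (hadj _ _ h).trans ih
  have hacyc : T.IsAcyclic := by
    intro v c hc
    have hle : T ≤ G := SimpleGraph.deleteEdges_le _
    have hC : IsCycleSubgraph (c.mapLe hle).toSubgraph := ⟨v, c.mapLe hle, hc.mapLe hle, rfl⟩
    have h1 := he _ hC
    rw [SimpleGraph.Walk.mem_edges_toSubgraph, SimpleGraph.Walk.edges_mapLe_eq_edges] at h1
    have h2 : _ ∈ (G.deleteEdges E).edgeSet := c.edges_subset_edgeSet h1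
    rw [SimpleGraph.edgeSet_deleteEdges] at h2
    exact h2.2 ⟨_, hC, rfl⟩
  have hcard := (SimpleGraph.IsTree.mk hconn hacyc).card_edgeFinset
  rw [← Set.ncard_coe_finset, SimpleGraph.coe_edgeFinset, hT, SimpleGraph.edgeSet_deleteEdges]
    at hcard
  have hsub : E ⊆ G.edgeSet := by
    rintro _ ⟨C, hC, rfl⟩
    exact C.edgeSet_subset (he C hC)
  have hEc : E.ncard = numCycles G := by
    refine Set.InjOn.ncard_image ?_
    intro C hC K hK hCK
    exact hG.cycle_eq_of_mem_edgeSet hC hK (he C hC) (hCK ▸ he K hK)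
  rw [← hEc]
  have := Set.ncard_sdiff_add_ncard_of_subset hsub
  omega

theorem IsCactus.three_mul_numCycles_add_le {V : Type*} [Finite V] {G : SimpleGraph V}
    (hG : IsCactus G) (B : Set (Sym2 V)) (hB : B ⊆ G.edgeSet)
    (hdisj : ∀ C : G.Subgraph, IsCycleSubgraph C → Disjoint C.edgeSet B) :
    3 * numCycles G + B.ncard ≤ G.edgeSet.ncard := by
  classical
  have hfin : {C : G.Subgraph | IsCycleSubgraph C}.Finite := Set.toFinite _
  set S : Set (Sym2 V) := ⋃ C ∈ {C : G.Subgraph | IsCycleSubgraph C}, C.edgeSet with hS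
  have h3 : 3 * numCycles G ≤ S.ncard := by
    have : S = ((hfin.toFinset.biUnion fun C => (Set.toFinite C.edgeSet).toFinset :
        Finset (Sym2 V)) : Set (Sym2 V)) := by
      ext e
      simp [hS]
    rw [this, Set.ncard_coe_finset, Finset.card_biUnion, numCycles, mul_comm,
      Set.ncard_eq_toFinset_card _ hfin]
    · rw [← smul_eq_mul]
      refine Finset.card_nsmul_le_sum _ _ _ fun C hC => ?_
      rw [← Set.ncard_eq_toFinset_card]
      exact IsCycleSubgraph.three_le_ncard_edgeSet (by simpa using hC)
    · intro C hC K hK hCK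
      rw [Function.onFun, Finset.disjoint_left]
      intro e h1 h2
      simp only [Set.Finite.mem_toFinset] at h1 h2
      simp only [Set.Finite.coe_toFinset] at hC hK
      exact hCK (hG.cycle_eq_of_mem_edgeSet hC hK h1 h2)
  have hd : Disjoint S B := by
    rw [hS, Set.disjoint_iUnion₂_left]
    exact hdisj
  have hSub : S ∪ B ⊆ G.edgeSet := by
    refine Set.union_subset ?_ hB
    refine Set.iUnion₂_subset fun C _ => C.edgeSet_subset
  have := Set.ncard_le_ncard hSub
  rw [Set.ncard_union_eq hd] at this
  omega

theorem IsCactus.two_mul_numCycles_lt {V : Type*} [Fintype V] {G : SimpleGraph V}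
    (hG : IsCactus G) : 2 * numCycles G + 1 ≤ Fintype.card V := by
  have h1 := hG.three_mul_numCycles_add_le ∅ (Set.empty_subset _) (by simp)
  have h2 := hG.ncard_edgeSet
  simp only [Set.ncard_empty] at h1
  omega

/-- The pendent edges serve as `B`: a leaf lies on no cycle, and two leaves sharing an edge would be
the whole graph. -/
theorem IsCactus.three_mul_numCycles_add_leaves_le {V : Type*} [Fintype V] {G : SimpleGraph V}
    (hG : IsCactus G) (hV : 3 ≤ Fintype.card V) :
    3 * numCycles G + {v | (G.neighborSet v).ncard = 1}.ncard ≤ G.edgeSet.ncard := by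
  classical
  have hex : ∀ v, ∃ w, (G.neighborSet v).ncard = 1 → G.neighborSet v = {w} := by
    intro v
    by_cases h : (G.neighborSet v).ncard = 1
    · obtain ⟨w, hw⟩ := Set.ncard_eq_one.1 h
      exact ⟨w, fun _ => hw⟩
    · exact ⟨v, fun h' => absurd h' h⟩
  choose nb hnb using hex
  have hadj : ∀ v, (G.neighborSet v).ncard = 1 → ∀ w, G.Adj v w ↔ w = nb v := by
    intro v hv w
    rw [← SimpleGraph.mem_neighborSet, hnb v hv, Set.mem_singleton_iff]
  have key := hG.three_mul_numCycles_add_le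
    ((fun v => s(v, nb v)) '' {v | (G.neighborSet v).ncard = 1}) ?_ ?_
  · rwa [Set.InjOn.ncard_image] at key
    intro v hv w hw hvw
    by_contra hne
    have hvw' : v = nb w ∧ nb v = w := by
      simpa [Sym2.eq_iff, hne] using hvw
    have hall : ∀ z, z ∈ ({v, w} : Set V) := by
      refine hG.1.mem_of_adj_closed (v := v) (by simp) ?_
      rintro x (rfl | hx) y hxy
      · rw [hadj _ hv] at hxy
        simp [hxy, hvw'.2]
      · rw [Set.mem_singleton_iff] at hx
        subst hx
        rw [hadj _ hw] at hxy
        simp [hxy, ← hvw'.1]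
    have : (Finset.univ : Finset V) ⊆ {v, w} := by
      intro z _
      simpa using hall z
    have h1 := Finset.card_le_card this
    have h2 := Finset.card_le_two (a := v) (b := w)
    rw [Finset.card_univ] at h1
    omega
  · rintro _ ⟨v, hv, rfl⟩
    exact (hadj v hv _).2 rfl
  · intro C hC
    rw [Set.disjoint_left]
    rintro _ he ⟨v, hv, rfl⟩
    have hv' : (G.neighborSet v).ncard = 1 := hv
    have hvC : v ∈ C.verts := (SimpleGraph.Subgraph.mem_edgeSet.1 he).fst_mem
    have h2 := hC.ncard_neighborSet hvC
    have := Set.ncard_le_ncard (C.neighborSet_subset v) (Set.toFinite _)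
    omega

theorem ncard_neighborSet_eq_degree {V : Type*} [Fintype V] (G : SimpleGraph V)
    [DecidableRel G.Adj] (v : V) : (G.neighborSet v).ncard = G.degree v := by
  rw [← SimpleGraph.card_neighborSet_eq_degree, ← Nat.card_coe_set_eq, Nat.card_eq_fintype_card]

/-- The excess of the degrees over two is at most `n - 3`. -/
theorem IsCactus.sum_degree_sub_two_le {V : Type*} [Fintype V] [DecidableEq V] {G : SimpleGraph V}
    [DecidableRel G.Adj] (hG : IsCactus G) (hV : 3 ≤ Fintype.card V) :
    ∑ v, (G.degree v - 2) ≤ Fintype.card V - 3 := by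
  have h1 := hG.three_mul_numCycles_add_leaves_le hV
  have h2 := hG.ncard_edgeSet
  have h3 := G.sum_degrees_eq_twice_card_edges
  rw [← Set.ncard_coe_finset, SimpleGraph.coe_edgeFinset] at h3
  have h4 : {v | (G.neighborSet v).ncard = 1}.ncard = ∑ v, if G.degree v = 1 then 1 else 0 := by
    rw [Finset.sum_boole, Nat.cast_id, ← Set.ncard_coe_finset]
    congr 1
    ext v
    simp [ncard_neighborSet_eq_degree]
  -- Truncated subtraction gives `d - 2 + 2 = d` for `d ≥ 2`, but `d + 1` at a leaf; hence the leaf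
  -- term.
  have h5 : ∑ v, (G.degree v - 2) + 2 * Fintype.card V
      = ∑ v, G.degree v + ∑ v, if G.degree v = 1 then 1 else 0 := by
    rw [← Finset.card_univ, ← Finset.sum_add_distrib, mul_comm, ← smul_eq_mul, ← Finset.sum_const,
      ← Finset.sum_add_distrib]
    refine Finset.sum_congr rfl fun v _ => ?_
    have : Nontrivial V := Fintype.one_lt_card_iff_nontrivial.1 (by omega)
    have := hG.1.preconnected.degree_pos_of_nontrivial v
    split_ifs <;> omega
  omega

/-! ### Superadditivity of the analytic excess -/

theorem superadditive_of_second_difference_nonneg {F : ℕ → ℝ} (h0 : F 0 = 0)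
    (h : ∀ y, 0 ≤ F (y + 2) - 2 * F (y + 1) + F y) (x y : ℕ) : F x + F y ≤ F (x + y) := by
  have hm : Monotone fun y => F (y + 1) - F y :=
    monotone_nat_of_le_succ fun y => by linarith [h y]
  induction y with
  | zero => simp [h0]
  | succ y ih =>
    have h1 : F (y + 1) - F y ≤ F (x + y + 1) - F (x + y) := hm (Nat.le_add_left y x)
    rw [← add_assoc]
    linarith

theorem monotone_of_second_difference_nonneg {F : ℕ → ℝ} (h1 : F 0 ≤ F 1)
    (h : ∀ y, 0 ≤ F (y + 2) - 2 * F (y + 1) + F y) : Monotone F := by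
  have hm : Monotone fun y => F (y + 1) - F y :=
    monotone_nat_of_le_succ fun y => by linarith [h y]
  refine monotone_nat_of_le_succ fun y => ?_
  have : F (0 + 1) - F 0 ≤ F (y + 1) - F y := hm (Nat.zero_le y)
  simp only [zero_add] at this
  linarith

theorem sum_le_apply_sum_of_superadditive {ι : Type*} {F : ℕ → ℝ} (h0 : F 0 = 0)
    (h : ∀ x y, F x + F y ≤ F (x + y)) (s : Finset ι) (d : ι → ℕ) :
    ∑ i ∈ s, F (d i) ≤ F (∑ i ∈ s, d i) := by
  classical
  induction s using Finset.induction_on with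
  | empty => simp [h0]
  | insert i s hi ih =>
    rw [Finset.sum_insert hi, Finset.sum_insert hi]
    linarith [h (d i) (∑ i ∈ s, d i)]

/-- The second difference of the function `x ↦ x ^ b`. -/
noncomputable def rpowSecondDiff (b x : ℝ) : ℝ := (x + 2) ^ b - 2 * (x + 1) ^ b + x ^ b

theorem hasDerivAt_rpowSecondDiff {a : ℝ} (ha : 1 ≤ a) (x : ℝ) :
    HasDerivAt (rpowSecondDiff (a + 1)) ((a + 1) * ((x + 2) ^ a - 2 * (x + 1) ^ a + x ^ a)) x := by
  have h1 : (1 : ℝ) ≤ a + 1 := by linarith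
  have hd : ∀ c : ℝ, HasDerivAt (fun x : ℝ => (x + c) ^ (a + 1)) ((a + 1) * (x + c) ^ a) x := by
    intro c
    have := ((hasDerivAt_id x).add_const c).rpow_const (p := a + 1) (Or.inr h1)
    simpa using this
  have := ((hd 2).sub ((hd 1).const_mul 2)).add (hd 0)
  simp only [add_zero] at this
  refine this.congr_deriv ?_
  ring

/-- The derivative is `a + 1` times a second difference of the convex function `x ↦ x ^ a`. -/
theorem rpowSecondDiff_monotoneOn {a : ℝ} (ha : 1 ≤ a) :
    MonotoneOn (rpowSecondDiff (a + 1)) (Set.Ici 0) := by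
  refine monotoneOn_of_deriv_nonneg (convex_Ici 0)
    (fun x _ => (hasDerivAt_rpowSecondDiff ha x).continuousAt.continuousWithinAt)
    (fun x _ => (hasDerivAt_rpowSecondDiff ha x).differentiableAt.differentiableWithinAt) ?_
  intro x hx
  rw [interior_Ici, Set.mem_Ioi] at hx
  rw [(hasDerivAt_rpowSecondDiff ha x).deriv]
  have := (convexOn_rpow ha).2 (Set.mem_Ici.2 hx.le)
    (Set.mem_Ici.2 (show (0 : ℝ) ≤ x + 2 by linarith)) (show (0 : ℝ) ≤ 1 / 2 by norm_num)
    (show (0 : ℝ) ≤ 1 / 2 by norm_num) (by norm_num)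
  simp only [smul_eq_mul] at this
  rw [show 1 / 2 * x + 1 / 2 * (x + 2) = x + 1 by ring] at this
  refine mul_nonneg (by linarith) (by linarith)

theorem rpowSecondDiff_strictMonoOn {a : ℝ} (ha : 1 < a) :
    StrictMonoOn (rpowSecondDiff (a + 1)) (Set.Ici 0) := by
  refine strictMonoOn_of_deriv_pos (convex_Ici 0)
    (fun x _ => (hasDerivAt_rpowSecondDiff ha.le x).continuousAt.continuousWithinAt) ?_
  intro x hx
  rw [interior_Ici, Set.mem_Ioi] at hx
  rw [(hasDerivAt_rpowSecondDiff ha.le x).deriv]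
  have := (strictConvexOn_rpow ha).2 (Set.mem_Ici.2 hx.le)
    (Set.mem_Ici.2 (show (0 : ℝ) ≤ x + 2 by linarith)) (by linarith)
    (show (0 : ℝ) < 1 / 2 by norm_num) (show (0 : ℝ) < 1 / 2 by norm_num) (by norm_num)
  simp only [smul_eq_mul] at this
  rw [show 1 / 2 * x + 1 / 2 * (x + 2) = x + 1 by ring] at this
  refine mul_pos (by linarith) (by linarith)

/-- What remains of `x ^ (a + 1)` after subtracting the quadratic that interpolates it at
`0`, `1`, `2`. -/
noncomputable def powExcess (a : ℝ) (x : ℕ) : ℝ :=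
  (x : ℝ) ^ (a + 1) - x - ((2 : ℝ) ^ (a + 1) - 2) * (x.choose 2 : ℝ)

theorem powExcess_zero {a : ℝ} (ha : 1 ≤ a) : powExcess a 0 = 0 := by
  simp [powExcess, Real.zero_rpow (show a + 1 ≠ 0 by linarith)]

theorem powExcess_one (a : ℝ) : powExcess a 1 = 0 := by
  simp [powExcess]

theorem powExcess_two (a : ℝ) : powExcess a 2 = 0 := by
  simp [powExcess]

/-- The subtracted quadratic has constant second difference; the interpolation at 0, 1, 2 makes this
constant the value at 0. -/
theorem powExcess_second_difference {a : ℝ} (ha : 1 ≤ a) (x : ℕ) :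
    powExcess a (x + 2) - 2 * powExcess a (x + 1) + powExcess a x
      = rpowSecondDiff (a + 1) x - rpowSecondDiff (a + 1) 0 := by
  have h0 : (0 : ℝ) ^ (a + 1) = 0 := Real.zero_rpow (by linarith)
  have hc : ((x + 2).choose 2 : ℝ) - 2 * ((x + 1).choose 2 : ℝ) + (x.choose 2 : ℝ) = 1 := by
    rw [Nat.cast_choose_two, Nat.cast_choose_two, Nat.cast_choose_two]
    push_cast
    ring
  simp only [powExcess, rpowSecondDiff, h0, zero_add, Real.one_rpow]
  push_cast
  linear_combination (-(2 : ℝ) ^ (a + 1) + 2) * hc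

theorem powExcess_second_difference_nonneg {a : ℝ} (ha : 1 ≤ a) (x : ℕ) :
    0 ≤ powExcess a (x + 2) - 2 * powExcess a (x + 1) + powExcess a x := by
  rw [powExcess_second_difference ha]
  have := rpowSecondDiff_monotoneOn ha (Set.mem_Ici.2 le_rfl)
    (Set.mem_Ici.2 (x.cast_nonneg (α := ℝ))) x.cast_nonneg
  linarith

theorem powExcess_three_pos {a : ℝ} (ha : 1 < a) : 0 < powExcess a 3 := by
  have h1 := powExcess_second_difference ha.le 1
  have := rpowSecondDiff_strictMonoOn ha (Set.mem_Ici.2 le_rfl)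
    (Set.mem_Ici.2 ((1 : ℕ).cast_nonneg (α := ℝ))) (by simp)
  rw [show 1 + 2 = 3 by rfl, show 1 + 1 = 2 by rfl, powExcess_two, powExcess_one] at h1
  linarith

/-- Since `powExcess a` vanishes at 0, 1, 2, it is a function `F` of the truncated difference `x -
2`, and this `F` is superadditive and monotone. -/
theorem sum_powExcess_le {a : ℝ} (ha : 1 ≤ a) {ι : Type*} (s : Finset ι) (d : ι → ℕ) {N : ℕ}
    (h : ∑ i ∈ s, (d i - 2) ≤ N - 2) : ∑ i ∈ s, powExcess a (d i) ≤ powExcess a N := by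
  set F : ℕ → ℝ := fun y => powExcess a (y + 2) with hF
  have h0 : F 0 = 0 := powExcess_two a
  have hsub : ∀ x, powExcess a x = F (x - 2) := by
    intro x
    match x with
    | 0 => rw [powExcess_zero ha]; exact h0.symm
    | 1 => rw [powExcess_one a]; exact h0.symm
    | x + 2 => rfl
  have h2 : ∀ y, 0 ≤ F (y + 2) - 2 * F (y + 1) + F y := fun y =>
    powExcess_second_difference_nonneg ha (y + 2)
  have h1 : F 0 ≤ F 1 := by
    have := powExcess_second_difference_nonneg ha 1
    rw [powExcess_one] at this
    have h3 : powExcess a (1 + 1) = 0 := powExcess_two a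
    rw [h3] at this
    rw [h0]
    have h4 : F 1 = powExcess a (1 + 2) := rfl
    linarith
  rw [hsub N]
  simp only [hsub (d _)]
  exact (sum_le_apply_sum_of_superadditive h0
    (superadditive_of_second_difference_nonneg h0 h2) s _).trans
    (monotone_of_second_difference_nonneg h1 h2 h)

/-! ### Short cycles as vertex sets -/

open Classical in
/-- The vertex sets of the cycles of `G`. -/
noncomputable def cycleSets {V : Type*} [Fintype V] (G : SimpleGraph V) : Finset (Finset V) :=
  Finset.univ.filter fun S => ∃ C : G.Subgraph, IsCycleSubgraph C ∧ C.verts = S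

theorem mem_cycleSets {V : Type*} [Fintype V] {G : SimpleGraph V} {S : Finset V} :
    S ∈ cycleSets G ↔ ∃ C : G.Subgraph, IsCycleSubgraph C ∧ C.verts = S := by
  simp [cycleSets]

theorem card_cycleSets_le {V : Type*} [Fintype V] (G : SimpleGraph V) :
    (cycleSets G).card ≤ numCycles G := by
  classical
  refine le_trans ?_ (Set.ncard_image_le (s := {C : G.Subgraph | IsCycleSubgraph C})
    (f := fun C => (Set.toFinite C.verts).toFinset) (Set.toFinite _))
  rw [← Set.ncard_coe_finset]
  refine Set.ncard_le_ncard ?_ (Set.toFinite _)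
  intro S hS
  obtain ⟨C, hC, hCS⟩ := mem_cycleSets.1 hS
  refine ⟨C, hC, ?_⟩
  ext x
  change x ∈ (Set.toFinite C.verts).toFinset ↔ _
  rw [Set.Finite.mem_toFinset, hCS, Finset.mem_coe]

theorem IsCactus.cycleSets_eq {V : Type*} [Fintype V] {G : SimpleGraph V} (hG : IsCactus G)
    {S T : Finset V} (hS : S ∈ cycleSets G) (hT : T ∈ cycleSets G) {x y : V} (hxy : x ≠ y)
    (hxS : x ∈ S) (hxT : x ∈ T) (hyS : y ∈ S) (hyT : y ∈ T) : S = T := by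
  obtain ⟨C, hC, hCS⟩ := mem_cycleSets.1 hS
  obtain ⟨K, hK, hKT⟩ := mem_cycleSets.1 hT
  have := hG.cycle_eq hC hK hxy (by simpa [hCS]) (by simpa [hKT]) (by simpa [hCS])
    (by simpa [hKT])
  subst this
  exact Finset.coe_injective (hCS.symm.trans hKT)

theorem triangle_mem_cycleSets {V : Type*} [Fintype V] [DecidableEq V] {G : SimpleGraph V}
    {u v w : V} (h1 : G.Adj u v) (h2 : G.Adj v w) (h3 : G.Adj w u) :
    ({u, v, w} : Finset V) ∈ cycleSets G := by
  refine mem_cycleSets.2 ⟨_, ⟨u, .cons h1 (.cons h2 (.cons h3 .nil)), ?_, rfl⟩, ?_⟩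
  · have := h1.ne
    have := h2.ne
    have := h3.ne
    rw [SimpleGraph.Walk.cons_isCycle_iff]
    simp
    grind
  · ext x
    rw [SimpleGraph.Walk.mem_verts_toSubgraph]
    simp
    grind

theorem fourCycle_mem_cycleSets {V : Type*} [Fintype V] [DecidableEq V] {G : SimpleGraph V}
    {u v w x : V} (h1 : G.Adj u v) (h2 : G.Adj v w) (h3 : G.Adj w x) (h4 : G.Adj x u)
    (huw : u ≠ w) (hvx : v ≠ x) : ({u, v, w, x} : Finset V) ∈ cycleSets G := by
  refine mem_cycleSets.2 ⟨_, ⟨u, .cons h1 (.cons h2 (.cons h3 (.cons h4 .nil))), ?_, rfl⟩, ?_⟩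
  · have := h1.ne
    have := h2.ne
    have := h3.ne
    have := h4.ne
    rw [SimpleGraph.Walk.cons_isCycle_iff]
    simp
    grind
  · ext x
    rw [SimpleGraph.Walk.mem_verts_toSubgraph]
    simp
    grind

theorem fiveCycle_mem_cycleSets {V : Type*} [Fintype V] [DecidableEq V] {G : SimpleGraph V}
    {u v w x y : V} (h1 : G.Adj u v) (h2 : G.Adj v w) (h3 : G.Adj w x) (h4 : G.Adj x y)
    (h5 : G.Adj y u) (hn : [u, v, w, x, y].Nodup) :
    ({u, v, w, x, y} : Finset V) ∈ cycleSets G := by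
  refine mem_cycleSets.2
    ⟨_, ⟨u, .cons h1 (.cons h2 (.cons h3 (.cons h4 (.cons h5 .nil)))), ?_, rfl⟩, ?_⟩
  · simp at hn
    rw [SimpleGraph.Walk.cons_isCycle_iff]
    simp
    grind
  · ext x
    rw [SimpleGraph.Walk.mem_verts_toSubgraph]
    simp
    grind

/-! ### Counting cherries -/

/-- The vertices `x ≠ y` are both out-neighbours or both in-neighbours of `v`. -/
def IsCherry {V : Type*} (D : Digraph V) (v x y : V) : Prop :=
  x ≠ y ∧ (D.Adj v x ∧ D.Adj v y ∨ D.Adj x v ∧ D.Adj y v)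

theorem outDeg_eq_card {V : Type*} [Fintype V] (D : Digraph V) (v : V)
    [DecidablePred fun w => D.Adj v w] :
    outDeg D v = (Finset.univ.filter fun w => D.Adj v w).card := by
  rw [outDeg, ← Set.ncard_coe_finset]
  simp

theorem inDeg_eq_card {V : Type*} [Fintype V] (D : Digraph V) (v : V)
    [DecidablePred fun w => D.Adj w v] :
    inDeg D v = (Finset.univ.filter fun w => D.Adj w v).card := by
  rw [inDeg, ← Set.ncard_coe_finset]
  simp

open Classical in
theorem IsOrientation.card_cherries {V : Type*} [Fintype V] {G : SimpleGraph V} {D : Digraph V}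
    (hD : IsOrientation G D) (v : V) :
    (Finset.univ.filter fun p : V × V => IsCherry D v p.1 p.2).card
      = outDeg D v * (outDeg D v - 1) + inDeg D v * (inDeg D v - 1) := by
  have h : (Finset.univ.filter fun p : V × V => IsCherry D v p.1 p.2)
      = (Finset.univ.filter fun w => D.Adj v w).offDiag
        ∪ (Finset.univ.filter fun w => D.Adj w v).offDiag := by
    ext ⟨x, y⟩
    rw [Finset.mem_filter]
    simp only [Finset.mem_filter, Finset.mem_univ, true_and, Finset.mem_union,
      Finset.mem_offDiag, IsCherry]
    tauto
  rw [h, Finset.card_union_of_disjoint, Finset.offDiag_card, Finset.offDiag_card,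
    ← outDeg_eq_card, ← inDeg_eq_card, Nat.mul_sub_one, Nat.mul_sub_one]
  rw [Finset.disjoint_left]
  rintro ⟨x, y⟩ h1 h2
  simp only [Finset.mem_offDiag, Finset.mem_filter, Finset.mem_univ, true_and] at h1 h2
  exact hD.2 _ _ ⟨h1.1, h2.1⟩

theorem IsOrientation.adj_left {V : Type*} {G : SimpleGraph V} {D : Digraph V}
    (hD : IsOrientation G D) {v x y : V} (h : IsCherry D v x y) : G.Adj v x := by
  rw [hD.1]
  rcases h.2 with h | h
  · exact Or.inl h.1
  · exact Or.inr h.1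

theorem IsOrientation.adj_right {V : Type*} {G : SimpleGraph V} {D : Digraph V}
    (hD : IsOrientation G D) {v x y : V} (h : IsCherry D v x y) : G.Adj v y := by
  rw [hD.1]
  rcases h.2 with h | h
  · exact Or.inl h.2
  · exact Or.inr h.2

open Classical in
-- A cyclic triangle has no cherry, a transitive one has a cherry at its source and one at its sink.
-- Ordering the ends turns two into four.
theorem IsOrientation.card_closed_cherries_le {V : Type*} [Fintype V] {G : SimpleGraph V}
    {D : Digraph V} (hD : IsOrientation G D) :
    (Finset.univ.filter fun t : V × V × V =>
      IsCherry D t.1 t.2.1 t.2.2 ∧ G.Adj t.2.1 t.2.2).card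
      ≤ 4 * ((cycleSets G).filter fun S => S.card = 3).card := by
  refine Finset.card_le_mul_card_image_of_maps_to
    (f := fun t : V × V × V => ({t.1, t.2.1, t.2.2} : Finset V)) ?_ 4 ?_
  · rintro ⟨v, x, y⟩ h
    simp only [Finset.mem_filter, Finset.mem_univ, true_and] at h ⊢
    refine ⟨triangle_mem_cycleSets (hD.adj_left h.1) h.2 (hD.adj_right h.1).symm, ?_⟩
    rw [Finset.card_eq_three]
    exact ⟨v, x, y, (hD.adj_left h.1).ne, (hD.adj_right h.1).ne, h.2.ne, rfl⟩
  · intro S _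
    rcases Finset.eq_empty_or_nonempty ({t ∈ Finset.univ.filter fun t : V × V × V =>
      IsCherry D t.1 t.2.1 t.2.2 ∧ G.Adj t.2.1 t.2.2 | ({t.1, t.2.1, t.2.2} : Finset V) = S})
      with he | ⟨⟨v, x, y⟩, ht⟩
    · rw [he]
      simp
    · simp only [Finset.mem_filter, Finset.mem_univ, true_and] at ht
      obtain ⟨⟨hch, hxy⟩, rfl⟩ := ht
      -- Here `z` is the middle vertex of the transitive triangle, while `v` and `w` are its source
      -- and sink in some order.
      obtain ⟨w, z, hz, hwz, hwz2⟩ : ∃ w z, ((w = x ∧ z = y) ∨ (w = y ∧ z = x)) ∧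
          ¬ IsCherry D z v w ∧ ¬ IsCherry D z w v := by
        have := hD.2 v x
        have := hD.2 v y
        have := hD.2 x y
        rcases (hD.1 x y).1 hxy with h | h <;> rcases hch.2 with h' | h'
        · exact ⟨y, x, by simp, by grind [IsCherry]⟩
        · exact ⟨x, y, by simp, by grind [IsCherry]⟩
        · exact ⟨x, y, by simp, by grind [IsCherry]⟩
        · exact ⟨y, x, by simp, by grind [IsCherry]⟩
      refine (Finset.card_le_card (t := {(v, w, z), (v, z, w), (w, v, z), (w, z, v)}) ?_).trans
        Finset.card_le_four
      rintro ⟨v', x', y'⟩ h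
      simp only [Finset.mem_filter, Finset.mem_univ, true_and] at h
      obtain ⟨⟨hch', hxy'⟩, hS⟩ := h
      have hv' : v' = v ∨ v' = w ∨ v' = z := by
        have : v' ∈ ({v, x, y} : Finset V) := by simp [← hS]
        simp at this
        grind
      have hx' : x' = v ∨ x' = w ∨ x' = z := by
        have : x' ∈ ({v, x, y} : Finset V) := by simp [← hS]
        simp at this
        grind
      have hy' : y' = v ∨ y' = w ∨ y' = z := by
        have : y' ∈ ({v, x, y} : Finset V) := by simp [← hS]
        simp at this
        grind
      have h1 := (hD.adj_left hch').ne
      have h2 := (hD.adj_right hch').ne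
      have h3 := hxy'.ne
      simp only [Finset.mem_insert, Finset.mem_singleton, Prod.mk.injEq]
      clear hS hch hxy hz hxy'
      rcases hv' with rfl | rfl | rfl <;> rcases hx' with rfl | rfl | rfl <;>
        rcases hy' with rfl | rfl | rfl <;> simp_all

open Classical in
-- The two ends and the two centres are the opposite pairs of a 4-cycle. Either pair can be the
-- ends, and each pair has two orderings: eight in all.
theorem IsOrientation.card_double_cherries_le {V : Type*} [Fintype V] {G : SimpleGraph V}
    {D : Digraph V} (hD : IsOrientation G D) :
    (Finset.univ.filter fun t : (V × V) × (V × V) =>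
      ¬ G.Adj t.1.1 t.1.2 ∧ t.2.1 ≠ t.2.2 ∧ IsCherry D t.2.1 t.1.1 t.1.2
        ∧ IsCherry D t.2.2 t.1.1 t.1.2).card
      ≤ 8 * ((cycleSets G).filter fun S => S.card = 4).card := by
  refine Finset.card_le_mul_card_image_of_maps_to
    (f := fun t : (V × V) × (V × V) => ({t.1.1, t.2.1, t.1.2, t.2.2} : Finset V)) ?_ 8 ?_
  · rintro ⟨⟨x, y⟩, v, w⟩ h
    simp only [Finset.mem_filter, Finset.mem_univ, true_and] at h ⊢
    obtain ⟨h1, h2, h3, h4⟩ := h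
    refine ⟨fourCycle_mem_cycleSets (hD.adj_left h3).symm (hD.adj_right h3)
      (hD.adj_right h4).symm (hD.adj_left h4) h3.1 h2, ?_⟩
    have := (hD.adj_left h3).ne
    have := (hD.adj_right h3).ne
    have := (hD.adj_left h4).ne
    have := (hD.adj_right h4).ne
    have := h3.1
    rw [Finset.card_insert_of_notMem, Finset.card_insert_of_notMem, Finset.card_insert_of_notMem,
      Finset.card_singleton] <;> simp <;> grind
  · intro S _
    rcases Finset.eq_empty_or_nonempty ({t ∈ Finset.univ.filter fun t : (V × V) × (V × V) =>
      ¬ G.Adj t.1.1 t.1.2 ∧ t.2.1 ≠ t.2.2 ∧ IsCherry D t.2.1 t.1.1 t.1.2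
        ∧ IsCherry D t.2.2 t.1.1 t.1.2 | ({t.1.1, t.2.1, t.1.2, t.2.2} : Finset V) = S})
      with he | ⟨⟨⟨x, y⟩, v, w⟩, ht⟩
    · rw [he]
      simp
    · simp only [Finset.mem_filter, Finset.mem_univ, true_and] at ht
      obtain ⟨⟨hn, hvw, hv, hw⟩, rfl⟩ := ht
      refine (Finset.card_le_card (t := {((x, y), (v, w)), ((x, y), (w, v)), ((y, x), (v, w)),
        ((y, x), (w, v)), ((v, w), (x, y)), ((v, w), (y, x)), ((w, v), (x, y)),
        ((w, v), (y, x))}) ?_).trans ((Finset.card_insert_le _ _).trans (Nat.succ_le_succ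
        ((Finset.card_insert_le _ _).trans (Nat.succ_le_succ Finset.card_le_six))))
      rintro ⟨⟨x', y'⟩, v', w'⟩ h
      simp only [Finset.mem_filter, Finset.mem_univ, true_and] at h
      obtain ⟨⟨hn', hvw', hv', hw'⟩, hS⟩ := h
      have mem : ∀ z ∈ ({x', v', y', w'} : Finset V), z = x ∨ z = v ∨ z = y ∨ z = w := by
        intro z hz
        rw [hS] at hz
        simpa using hz
      have hx := mem x' (by simp)
      have hy := mem y' (by simp)
      have hv1 := mem v' (by simp)
      have hw1 := mem w' (by simp)
      have a1 := hD.adj_left hv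
      have a2 := hD.adj_right hv
      have a3 := hD.adj_left hw
      have a4 := hD.adj_right hw
      have b1 := (hD.adj_left hv').ne
      have b2 := (hD.adj_right hv').ne
      have b3 := (hD.adj_left hw').ne
      have b4 := (hD.adj_right hw').ne
      have c1 := hv.1
      have c2 := hv'.1
      have hpair : (x' = x ∧ y' = y) ∨ (x' = y ∧ y' = x) ∨ (x' = v ∧ y' = w)
          ∨ (x' = w ∧ y' = v) := by
        have := a1.symm
        have := a2.symm
        have := a3.symm
        have := a4.symm
        clear hS mem hv hw hv' hw' hv1 hw1
        rcases hx with rfl | rfl | rfl | rfl <;> rcases hy with rfl | rfl | rfl | rfl <;> simp_all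
      have := a1.ne
      have := a2.ne
      have := a3.ne
      have := a4.ne
      simp only [Finset.mem_insert, Finset.mem_singleton, Prod.mk.injEq]
      clear hS mem hv hw hv' hw' hn hn' hx hy a1 a2 a3 a4
      rcases hpair with ⟨rfl, rfl⟩ | ⟨rfl, rfl⟩ | ⟨rfl, rfl⟩ | ⟨rfl, rfl⟩ <;> grind

theorem two_mul_choose_two (x : ℕ) : 2 * x.choose 2 = x * (x - 1) := by
  rw [Nat.choose_two_right, Nat.mul_div_cancel' (Nat.even_mul_pred_self x).two_dvd]

open Classical in
theorem card_nonadjacent_pairs {V : Type*} [Fintype V] (G : SimpleGraph V) :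
    (Finset.univ.filter fun p : V × V => p.1 ≠ p.2 ∧ ¬ G.Adj p.1 p.2).card
      + 2 * G.edgeSet.ncard + Fintype.card V = Fintype.card V * Fintype.card V := by
  have hm : 2 * G.edgeSet.ncard = ∑ p : V × V, if G.Adj p.1 p.2 then 1 else 0 := by
    rw [Fintype.sum_prod_type, ← SimpleGraph.coe_edgeFinset, Set.ncard_coe_finset,
      ← G.sum_degrees_eq_twice_card_edges]
    refine Finset.sum_congr rfl fun v _ => ?_
    rw [Finset.sum_boole, Nat.cast_id, ← SimpleGraph.card_neighborFinset_eq_degree]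
    congr 1
    ext w
    simp
  have hn : Fintype.card V = ∑ p : V × V, if p.1 = p.2 then 1 else 0 := by
    rw [Fintype.sum_prod_type]
    simp
  rw [hm]
  nth_rewrite 1 [hn]
  rw [← Fintype.card_prod, Finset.card_filter, ← Finset.card_univ (α := V × V),
    Finset.card_eq_sum_ones, ← Finset.sum_add_distrib, ← Finset.sum_add_distrib]
  refine Finset.sum_congr rfl fun p _ => ?_
  by_cases h : p.1 = p.2
  · simp [h]
  · by_cases h' : G.Adj p.1 p.2 <;> simp [h, h']

open Classical in
/-- Counting the pairs of vertices with a common out- or in-neighbour. -/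
theorem IsOrientation.sum_cherries_le {V : Type*} [Fintype V] {G : SimpleGraph V} {D : Digraph V}
    (hD : IsOrientation G D) :
    2 * ∑ v, ((outDeg D v).choose 2 + (inDeg D v).choose 2)
      + (Finset.univ.filter fun p : V × V =>
          p.1 ≠ p.2 ∧ ¬ G.Adj p.1 p.2 ∧ ∀ v, ¬ IsCherry D v p.1 p.2).card
      + 2 * G.edgeSet.ncard + Fintype.card V
      ≤ Fintype.card V * Fintype.card V
        + 4 * (((cycleSets G).filter fun S => S.card = 3).card
          + ((cycleSets G).filter fun S => S.card = 4).card) := by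
  set c : V × V → ℕ := fun p => (Finset.univ.filter fun v => IsCherry D v p.1 p.2).card with hc
  have hsum : 2 * ∑ v, ((outDeg D v).choose 2 + (inDeg D v).choose 2) = ∑ p, c p := by
    rw [Finset.mul_sum]
    have : ∀ v, 2 * ((outDeg D v).choose 2 + (inDeg D v).choose 2)
        = ∑ p : V × V, if IsCherry D v p.1 p.2 then 1 else 0 := by
      intro v
      rw [mul_add, two_mul_choose_two, two_mul_choose_two, ← hD.card_cherries v,
        Finset.card_filter]
    simp only [this]
    rw [Finset.sum_comm]
    simp only [hc, Finset.card_filter]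
  have hclosed : ∑ p : V × V, (if G.Adj p.1 p.2 then c p else 0)
      ≤ 4 * ((cycleSets G).filter fun S => S.card = 3).card := by
    refine le_of_eq_of_le ?_ hD.card_closed_cherries_le
    rw [Finset.card_filter]
    refine Eq.trans ?_ (Fintype.sum_prod_type_right _).symm
    refine Finset.sum_congr rfl fun p _ => ?_
    by_cases h : G.Adj p.1 p.2 <;> simp [h, hc]
  have hdouble : ∑ p : V × V, (if G.Adj p.1 p.2 then 0 else c p * (c p - 1))
      ≤ 8 * ((cycleSets G).filter fun S => S.card = 4).card := by
    refine le_of_eq_of_le ?_ hD.card_double_cherries_le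
    rw [Finset.card_filter]
    refine Eq.trans ?_ (Fintype.sum_prod_type _).symm
    refine Finset.sum_congr rfl fun p _ => ?_
    by_cases h : G.Adj p.1 p.2
    · simp [h]
    · rw [if_neg h, ← Finset.card_filter, Nat.mul_sub_one, ← Finset.offDiag_card]
      congr 1
      ext q
      simp only [Finset.mem_filter, Finset.mem_univ, true_and, Finset.mem_offDiag]
      tauto
  have hN := card_nonadjacent_pairs G
  have hsplit : ∑ p, c p = ∑ p : V × V, (if G.Adj p.1 p.2 then c p else 0)
      + ∑ p : V × V, (if G.Adj p.1 p.2 then 0 else c p) := by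
    rw [← Finset.sum_add_distrib]
    refine Finset.sum_congr rfl fun p _ => ?_
    split_ifs <;> simp
  have hopen : 2 * ∑ p : V × V, (if G.Adj p.1 p.2 then 0 else c p)
      + 2 * (Finset.univ.filter fun p : V × V =>
          p.1 ≠ p.2 ∧ ¬ G.Adj p.1 p.2 ∧ ∀ v, ¬ IsCherry D v p.1 p.2).card
      ≤ 2 * (Finset.univ.filter fun p : V × V => p.1 ≠ p.2 ∧ ¬ G.Adj p.1 p.2).card
        + ∑ p : V × V, (if G.Adj p.1 p.2 then 0 else c p * (c p - 1)) := by
    rw [Finset.card_filter, Finset.card_filter, Finset.mul_sum, Finset.mul_sum, Finset.mul_sum,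
      ← Finset.sum_add_distrib, ← Finset.sum_add_distrib]
    -- For a nonadjacent pair with `c p ≥ 1` this is `2 * c ≤ 2 + c * (c - 1)`; a pair without
    -- cherry contributes 2 to both sides.
    refine Finset.sum_le_sum fun p _ => ?_
    by_cases h : G.Adj p.1 p.2
    · simp [h]
    by_cases he : p.1 = p.2
    · have : c p = 0 := by
        simp only [hc, Finset.card_eq_zero, Finset.filter_eq_empty_iff]
        exact fun v _ hv => hv.1 he
      simp [he, this]
    by_cases hz : ∀ v, ¬ IsCherry D v p.1 p.2
    · have : c p = 0 := by
        simp only [hc, Finset.card_eq_zero, Finset.filter_eq_empty_iff]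
        exact fun v _ => hz v
      simp [h, he, hz, this]
    · simp only [h, he, hz, ne_eq, not_false_eq_true, and_false, and_self, if_true, if_false]
      rcases Nat.lt_or_ge (c p) 2 with h2 | h2
      · omega
      · have : 2 * (c p - 1) ≤ c p * (c p - 1) := Nat.mul_le_mul_right _ h2
        omega
  omega

/-! ### The two estimates and the bound -/

theorem IsOrientation.outDeg_add_inDeg {V : Type*} [Fintype V] {G : SimpleGraph V}
    {D : Digraph V} (hD : IsOrientation G D) (v : V) :
    outDeg D v + inDeg D v = (G.neighborSet v).ncard := by
  have : G.neighborSet v = {w | D.Adj v w} ∪ {w | D.Adj w v} := by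
    ext w
    simp [hD.1]
  rw [this, Set.ncard_union_eq, outDeg, inDeg]
  rw [Set.disjoint_left]
  exact fun w h1 h2 => hD.2 _ _ ⟨h1, h2⟩

theorem IsOrientation.sum_outDeg_add_inDeg {V : Type*} [Fintype V] {G : SimpleGraph V}
    {D : Digraph V} (hD : IsOrientation G D) :
    ∑ v, (outDeg D v + inDeg D v) = 2 * G.edgeSet.ncard := by
  classical
  simp only [hD.outDeg_add_inDeg, ncard_neighborSet_eq_degree]
  rw [G.sum_degrees_eq_twice_card_edges, ← Set.ncard_coe_finset, SimpleGraph.coe_edgeFinset]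

theorem sum_outDeg_eq_sum_inDeg {V : Type*} [Fintype V] (D : Digraph V) :
    ∑ v, outDeg D v = ∑ v, inDeg D v := by
  classical
  simp only [outDeg_eq_card, inDeg_eq_card, Finset.card_filter]
  exact Finset.sum_comm

theorem randic_eq_sum {V : Type*} [Fintype V] (D : Digraph V) {a : ℝ} (ha : 1 ≤ a) :
    randic (a + 1) D
      = 1 / 2 * ∑ v, ((outDeg D v : ℝ) ^ (a + 1) + (inDeg D v : ℝ) ^ (a + 1)) := by
  classical
  have hpow : ∀ k : ℕ, (k : ℝ) * (k : ℝ) ^ a = (k : ℝ) ^ (a + 1) := by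
    intro k
    rw [mul_comm, Real.rpow_add_one' k.cast_nonneg (by linarith)]
  rw [randic]
  congr 1
  rw [add_sub_cancel_right, Finset.sum_add_distrib, Finset.sum_add_distrib, Finset.sum_filter,
    Finset.sum_filter, Fintype.sum_prod_type, Fintype.sum_prod_type_right]
  congr 1
  · refine Finset.sum_congr rfl fun v _ => ?_
    dsimp only
    rw [← Finset.sum_filter, Finset.sum_const, nsmul_eq_mul, ← hpow]
    congr 2
    rw [outDeg_eq_card]
  · refine Finset.sum_congr rfl fun v _ => ?_
    dsimp only
    rw [← Finset.sum_filter, Finset.sum_const, nsmul_eq_mul, ← hpow]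
    congr 2
    rw [inDeg_eq_card]

open Classical in
-- The slack terms, for nonadjacent pairs without a cherry and for longer cycles, are kept so that
-- the case of equality can be read off.
theorem IsCactus.two_mul_sum_choose_add_le {V : Type*} [Fintype V] {G : SimpleGraph V}
    (hG : IsCactus G) {D : Digraph V} (hD : IsOrientation G D) :
    2 * ∑ v, ((outDeg D v).choose 2 + (inDeg D v).choose 2)
      + (Finset.univ.filter fun p : V × V =>
          p.1 ≠ p.2 ∧ ¬ G.Adj p.1 p.2 ∧ ∀ v, ¬ IsCherry D v p.1 p.2).card
      + 4 * ((cycleSets G).filter fun S => S.card ≠ 3 ∧ S.card ≠ 4).card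
      ≤ 2 * ((Fintype.card V - 1).choose 2 + numCycles G) := by
  have h1 := hD.sum_cherries_le
  have h2 := hG.ncard_edgeSet
  have h3 := card_cycleSets_le G
  have h4 : ((cycleSets G).filter fun S => S.card = 3).card
      + ((cycleSets G).filter fun S => S.card = 4).card
      + ((cycleSets G).filter fun S => S.card ≠ 3 ∧ S.card ≠ 4).card = (cycleSets G).card := by
    rw [Finset.card_filter, Finset.card_filter, Finset.card_filter, Finset.card_eq_sum_ones,
      ← Finset.sum_add_distrib, ← Finset.sum_add_distrib]
    refine Finset.sum_congr rfl fun S _ => ?_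
    split_ifs <;> omega
  have hpos : 0 < Fintype.card V := Fintype.card_pos_iff.2 hG.1.nonempty
  obtain ⟨k, hk⟩ : ∃ k, Fintype.card V = k + 1 := ⟨Fintype.card V - 1, by omega⟩
  rw [hk] at h1 h2 ⊢
  rw [mul_add 2, two_mul_choose_two, Nat.add_sub_cancel, Nat.mul_sub_one]
  have h5 : (k + 1) * (k + 1) = k * k + 2 * k + 1 := by ring
  have h6 : k ≤ k * k := Nat.le_mul_self k
  omega

theorem IsCactus.sum_choose_le {V : Type*} [Fintype V] {G : SimpleGraph V}
    (hG : IsCactus G) {D : Digraph V} (hD : IsOrientation G D) :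
    ∑ v, ((outDeg D v).choose 2 + (inDeg D v).choose 2)
      ≤ (Fintype.card V - 1).choose 2 + numCycles G := by
  have := hG.two_mul_sum_choose_add_le hD
  omega

/-- Out- and in-degrees form one family over `V ⊕ V`; at each vertex their truncated excesses over
two add up to at most that of the degree. -/
theorem IsCactus.sum_powExcess_le {V : Type*} [Fintype V] {G : SimpleGraph V}
    (hG : IsCactus G) {D : Digraph V} (hD : IsOrientation G D) {a : ℝ} (ha : 1 ≤ a) :
    ∑ v, (powExcess a (outDeg D v) + powExcess a (inDeg D v))
      ≤ powExcess a (Fintype.card V - 1) := by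
  classical
  have h := CactusRandic.sum_powExcess_le ha (Finset.univ : Finset (V ⊕ V))
    (Sum.elim (outDeg D) (inDeg D)) (N := Fintype.card V - 1) ?_
  · rw [Fintype.sum_sum_type, ← Finset.sum_add_distrib] at h
    exact h
  · rw [Fintype.sum_sum_type, ← Finset.sum_add_distrib]
    simp only [Sum.elim_inl, Sum.elim_inr]
    have hdeg : ∀ v, outDeg D v + inDeg D v = G.degree v := fun v => by
      rw [hD.outDeg_add_inDeg, ncard_neighborSet_eq_degree]
    rcases Nat.lt_or_ge (Fintype.card V) 3 with hV | hV
    · rw [Finset.sum_eq_zero]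
      · exact Nat.zero_le _
      · intro v _
        have := hdeg v
        have := G.degree_lt_card_verts v
        omega
    · refine le_trans (Finset.sum_le_sum fun v _ => ?_) ((hG.sum_degree_sub_two_le hV).trans ?_)
      · have := hdeg v
        omega
      · omega

/-- The defect in the bound splits into a combinatorial and an analytic part. -/
theorem IsCactus.randic_sub_bound {V : Type*} [Fintype V] {G : SimpleGraph V}
    (hG : IsCactus G) {D : Digraph V} (hD : IsOrientation G D) {a : ℝ} (ha : 1 ≤ a) :
    randic (a + 1) D - (1 / 2) * (((Fintype.card V : ℝ) - 1) ^ (a + 1) + (Fintype.card V : ℝ) - 1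
        + 2 * (numCycles G : ℝ) * (2 : ℝ) ^ a)
      = 1 / 2 * (((2 : ℝ) ^ (a + 1) - 2)
          * (((∑ v, ((outDeg D v).choose 2 + (inDeg D v).choose 2) : ℕ) : ℝ)
            - (((Fintype.card V - 1).choose 2 + numCycles G : ℕ) : ℝ))
          + (∑ v, (powExcess a (outDeg D v) + powExcess a (inDeg D v))
            - powExcess a (Fintype.card V - 1))) := by
  have hpos : 0 < Fintype.card V := Fintype.card_pos_iff.2 hG.1.nonempty
  obtain ⟨k, hk⟩ : ∃ k, Fintype.card V = k + 1 := ⟨Fintype.card V - 1, by omega⟩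
  have h1 := hD.sum_outDeg_add_inDeg
  have h2 := hG.ncard_edgeSet
  have h3 : (∑ v, ((outDeg D v : ℝ) + (inDeg D v : ℝ))) = 2 * ((k : ℝ) + numCycles G) := by
    rw [hk] at h2
    have : ∑ v, (outDeg D v + inDeg D v) = 2 * (k + numCycles G) := by omega
    exact_mod_cast this
  have hpow : ∀ x : ℕ, (x : ℝ) ^ (a + 1)
      = x + ((2 : ℝ) ^ (a + 1) - 2) * (x.choose 2 : ℝ) + powExcess a x := by
    intro x
    rw [powExcess]
    ring
  have hS : ∑ v, ((outDeg D v : ℝ) ^ (a + 1) + (inDeg D v : ℝ) ^ (a + 1))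
      = ∑ v, ((outDeg D v : ℝ) + (inDeg D v : ℝ))
        + ((2 : ℝ) ^ (a + 1) - 2)
          * ((∑ v, ((outDeg D v).choose 2 + (inDeg D v).choose 2) : ℕ) : ℝ)
        + ∑ v, (powExcess a (outDeg D v) + powExcess a (inDeg D v)) := by
    push_cast
    rw [Finset.mul_sum, ← Finset.sum_add_distrib, ← Finset.sum_add_distrib]
    refine Finset.sum_congr rfl fun v _ => ?_
    rw [hpow, hpow]
    ring
  have h2a : (2 : ℝ) ^ (a + 1) = 2 ^ a * 2 := Real.rpow_add_one (by norm_num) a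
  rw [randic_eq_sum D ha, hS, h3, hk, Nat.add_sub_cancel]
  have hk1 : (((k + 1 : ℕ) : ℝ) - 1) = k := by
    push_cast
    ring
  rw [hk1, hpow k, h2a]
  push_cast
  ring

theorem IsCactus.randic_le {V : Type*} [Fintype V] {G : SimpleGraph V}
    (hG : IsCactus G) {D : Digraph V} (hD : IsOrientation G D) {a : ℝ} (ha : 1 ≤ a) :
    randic (a + 1) D ≤ (1 / 2) * (((Fintype.card V : ℝ) - 1) ^ (a + 1) + (Fintype.card V : ℝ) - 1
        + 2 * (numCycles G : ℝ) * (2 : ℝ) ^ a) ∧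
      (randic (a + 1) D = (1 / 2) * (((Fintype.card V : ℝ) - 1) ^ (a + 1)
          + (Fintype.card V : ℝ) - 1 + 2 * (numCycles G : ℝ) * (2 : ℝ) ^ a) ↔
        ∑ v, ((outDeg D v).choose 2 + (inDeg D v).choose 2)
            = (Fintype.card V - 1).choose 2 + numCycles G ∧
          ∑ v, (powExcess a (outDeg D v) + powExcess a (inDeg D v))
            = powExcess a (Fintype.card V - 1)) := by
  have h := hG.randic_sub_bound hD ha
  have h1 : ((∑ v, ((outDeg D v).choose 2 + (inDeg D v).choose 2) : ℕ) : ℝ)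
      ≤ (((Fintype.card V - 1).choose 2 + numCycles G : ℕ) : ℝ) :=
    Nat.cast_le.2 (hG.sum_choose_le hD)
  have h2 := hG.sum_powExcess_le hD ha
  -- The strict sign makes equality force the cherry count to be extremal for every `a ≥ 1`.
  have hα : (0 : ℝ) < (2 : ℝ) ^ (a + 1) - 2 := by
    have : (2 : ℝ) ^ (1 : ℝ) < (2 : ℝ) ^ (a + 1) :=
      Real.rpow_lt_rpow_of_exponent_lt (by norm_num) (by linarith)
    rw [Real.rpow_one] at this
    linarith
  have h3 := mul_nonpos_of_nonneg_of_nonpos hα.le (sub_nonpos.2 h1)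
  refine ⟨by linarith, fun he => ?_, fun ⟨e1, e2⟩ => ?_⟩
  · have h4 : ((2 : ℝ) ^ (a + 1) - 2)
        * (((∑ v, ((outDeg D v).choose 2 + (inDeg D v).choose 2) : ℕ) : ℝ)
          - (((Fintype.card V - 1).choose 2 + numCycles G : ℕ) : ℝ)) = 0 := by linarith
    rcases mul_eq_zero.1 h4 with h5 | h5
    · exact absurd h5 hα.ne'
    · exact ⟨Nat.cast_injective (R := ℝ) (by linarith), by linarith⟩
  · rw [e1, e2] at h
    linarith

/-! ### Universal sources; sinks follow by reversal -/

/-- The vertex `u` has an arc to every other vertex. -/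
def IsUniversalSource {V : Type*} (D : Digraph V) (u : V) : Prop :=
  ∀ v, v ≠ u → D.Adj u v

/-- The digraph with all arcs reversed. -/
def reverseDigraph {V : Type*} (D : Digraph V) : Digraph V where
  Adj u v := D.Adj v u

theorem IsOrientation.reverse {V : Type*} {G : SimpleGraph V} {D : Digraph V}
    (hD : IsOrientation G D) : IsOrientation G (reverseDigraph D) :=
  ⟨fun u v => (hD.1 u v).trans or_comm, fun u v h => hD.2 v u h⟩

theorem IsOrientation.irrefl {V : Type*} {G : SimpleGraph V} {D : Digraph V}
    (hD : IsOrientation G D) (v : V) : ¬ D.Adj v v := fun h => hD.2 v v ⟨h, h⟩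

theorem IsOrientation.isUniversalSource_of_le {V : Type*} [Fintype V] {G : SimpleGraph V}
    {D : Digraph V} (hD : IsOrientation G D) {u : V} (h : Fintype.card V ≤ outDeg D u + 1) :
    IsUniversalSource D u := by
  classical
  intro v hv
  by_contra hn
  rw [outDeg_eq_card] at h
  have h2 : (Finset.univ.filter fun w => D.Adj u w) ⊆ Finset.univ \ {u, v} := by
    intro w hw
    simp only [Finset.mem_filter, Finset.mem_univ, true_and] at hw
    simp only [Finset.mem_sdiff, Finset.mem_univ, true_and, Finset.mem_insert,
      Finset.mem_singleton]
    rintro (rfl | rfl)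
    · exact hD.irrefl _ hw
    · exact hn hw
  have h3 := Finset.card_le_card h2
  rw [Finset.card_sdiff_of_subset (Finset.subset_univ _), Finset.card_pair hv.symm,
    Finset.card_univ] at h3
  have h4 : ({u, v} : Finset V).card ≤ Fintype.card V := Finset.card_le_univ _
  rw [Finset.card_pair hv.symm] at h4
  omega

theorem IsUniversalSource.outDeg_add_one {V : Type*} [Fintype V] {G : SimpleGraph V}
    {D : Digraph V} {u : V} (hu : IsUniversalSource D u) (hD : IsOrientation G D) :
    outDeg D u + 1 = Fintype.card V := by
  classical
  have : (Finset.univ.filter fun w => D.Adj u w) = Finset.univ.erase u := by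
    ext w
    simp only [Finset.mem_filter, Finset.mem_univ, true_and, Finset.mem_erase, and_true]
    exact ⟨fun h h' => hD.irrefl u (h' ▸ h), hu w⟩
  rw [outDeg_eq_card, this, Finset.card_erase_add_one (Finset.mem_univ u), Finset.card_univ]

theorem IsUniversalSource.inDeg_eq_zero {V : Type*} [Finite V] {G : SimpleGraph V} {D : Digraph V}
    {u : V} (hu : IsUniversalSource D u) (hD : IsOrientation G D) : inDeg D u = 0 := by
  rw [inDeg, Set.ncard_eq_zero, Set.eq_empty_iff_forall_notMem]
  intro v hv
  by_cases h : v = u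
  · subst h
    exact hD.irrefl _ hv
  · exact hD.2 _ _ ⟨hv, hu v h⟩

/-- In a cactus, the graph induced on the other vertices by a universal vertex is a matching. -/
theorem IsCactus.eq_of_adj_of_adj {V : Type*} [Fintype V] {G : SimpleGraph V} (hG : IsCactus G)
    {u v w x : V} (huv : G.Adj u v) (huw : G.Adj u w) (hux : G.Adj u x) (hvw : G.Adj v w)
    (hvx : G.Adj v x) : w = x := by
  classical
  have h := hG.cycleSets_eq (triangle_mem_cycleSets huv hvw huw.symm)
    (triangle_mem_cycleSets huv hvx hux.symm) huv.ne (by simp) (by simp) (by simp) (by simp)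
  have hw : w ∈ ({u, v, x} : Finset V) := by
    rw [← h]
    simp
  simp only [Finset.mem_insert, Finset.mem_singleton] at hw
  rcases hw with rfl | rfl | h
  · exact absurd rfl huw.ne
  · exact absurd rfl hvw.ne
  · exact h

theorem IsUniversalSource.adj {V : Type*} {G : SimpleGraph V} {D : Digraph V} {u : V}
    (hu : IsUniversalSource D u) (hD : IsOrientation G D) {v : V} (hv : v ≠ u) : G.Adj u v :=
  (hD.1 u v).2 (Or.inl (hu v hv))

theorem IsUniversalSource.eq_of_adj_of_adj {V : Type*} [Fintype V] {G : SimpleGraph V}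
    {D : Digraph V} {u : V} (hu : IsUniversalSource D u) (hG : IsCactus G)
    (hD : IsOrientation G D) {v w x : V} (hv : v ≠ u) (hw : w ≠ u) (hx : x ≠ u)
    (hvw : G.Adj v w) (hvx : G.Adj v x) : w = x :=
  hG.eq_of_adj_of_adj (hu.adj hD hv) (hu.adj hD hw) (hu.adj hD hx) hvw hvx

theorem IsUniversalSource.outDeg_le_one {V : Type*} [Fintype V] {G : SimpleGraph V}
    {D : Digraph V} {u : V} (hu : IsUniversalSource D u) (hG : IsCactus G)
    (hD : IsOrientation G D) {v : V} (hv : v ≠ u) : outDeg D v ≤ 1 := by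
  rw [outDeg, Set.ncard_le_one_iff]
  intro w x hw hx
  have hne : ∀ z, D.Adj v z → z ≠ u := by
    rintro z hz rfl
    exact hD.2 _ _ ⟨hz, hu v hv⟩
  exact hu.eq_of_adj_of_adj hG hD hv (hne w hw) (hne x hx) ((hD.1 _ _).2 (Or.inl hw))
    ((hD.1 _ _).2 (Or.inl hx))

theorem IsUniversalSource.inDeg_le_two {V : Type*} [Fintype V] {G : SimpleGraph V}
    {D : Digraph V} {u : V} (hu : IsUniversalSource D u) (hG : IsCactus G)
    (hD : IsOrientation G D) {v : V} (hv : v ≠ u) : 1 ≤ inDeg D v ∧ inDeg D v ≤ 2 := by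
  have h1 : ({w | D.Adj w v} \ {u}).ncard ≤ 1 := by
    rw [Set.ncard_le_one_iff]
    rintro w x ⟨hw, hwu⟩ ⟨hx, hxu⟩
    exact hu.eq_of_adj_of_adj hG hD hv hwu hxu ((hD.1 _ _).2 (Or.inr hw))
      ((hD.1 _ _).2 (Or.inr hx))
  have h2 := Set.ncard_sdiff_singleton_add_one (s := {w | D.Adj w v}) (a := u) (hu v hv)
  rw [inDeg]
  omega

/-- Away from `u` the out-degree is at most one and the in-degree one or two. So the sum there
counts vertices of in-degree two, which number the edges minus `n - 1`, that is `r`. -/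
theorem IsUniversalSource.sum_choose_eq {V : Type*} [Fintype V] {G : SimpleGraph V}
    {D : Digraph V} {u : V} (hu : IsUniversalSource D u) (hG : IsCactus G)
    (hD : IsOrientation G D) :
    ∑ v, ((outDeg D v).choose 2 + (inDeg D v).choose 2)
      = (Fintype.card V - 1).choose 2 + numCycles G := by
  classical
  have h0 := hu.outDeg_add_one hD
  have h1 := hu.inDeg_eq_zero hD
  have h2 := hD.sum_outDeg_add_inDeg
  have h3 := sum_outDeg_eq_sum_inDeg D
  have h4 := hG.ncard_edgeSet
  rw [Finset.sum_add_distrib] at h2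
  have h5 : ∑ v ∈ Finset.univ.erase u, ((outDeg D v).choose 2 + (inDeg D v).choose 2)
      + (Fintype.card V - 1) = ∑ v, inDeg D v := by
    rw [← Finset.add_sum_erase _ (inDeg D) (Finset.mem_univ u), h1, zero_add, ← Finset.card_univ,
      ← Finset.card_erase_of_mem (Finset.mem_univ u), Finset.card_eq_sum_ones,
      ← Finset.sum_add_distrib]
    refine Finset.sum_congr rfl fun v hv => ?_
    have hvu := Finset.ne_of_mem_erase hv
    have h6 := hu.outDeg_le_one hG hD hvu
    obtain ⟨h7, h8⟩ := hu.inDeg_le_two hG hD hvu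
    interval_cases outDeg D v <;> interval_cases inDeg D v <;> rfl
  rw [← Finset.add_sum_erase _ _ (Finset.mem_univ u), h1]
  have h8 : outDeg D u = Fintype.card V - 1 := by omega
  rw [h8]
  simp only [Nat.choose_zero_succ, add_zero]
  omega

theorem powExcess_eq_zero {a : ℝ} (ha : 1 ≤ a) {x : ℕ} (hx : x ≤ 2) : powExcess a x = 0 := by
  interval_cases x
  · exact powExcess_zero ha
  · exact powExcess_one a
  · exact powExcess_two a

theorem IsUniversalSource.sum_powExcess_eq {V : Type*} [Fintype V] {G : SimpleGraph V}
    {D : Digraph V} {u : V} (hu : IsUniversalSource D u) (hG : IsCactus G)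
    (hD : IsOrientation G D) {a : ℝ} (ha : 1 ≤ a) :
    ∑ v, (powExcess a (outDeg D v) + powExcess a (inDeg D v))
      = powExcess a (Fintype.card V - 1) := by
  rw [Finset.sum_eq_single u, hu.inDeg_eq_zero hD, powExcess_zero ha, add_zero,
    ← hu.outDeg_add_one hD, Nat.add_sub_cancel]
  · intro v _ hvu
    have h6 := hu.outDeg_le_one hG hD hvu
    have h7 := hu.inDeg_le_two hG hD hvu
    rw [powExcess_eq_zero ha (by omega), powExcess_eq_zero ha h7.2, add_zero]
  · intro h
    exact absurd (Finset.mem_univ u) h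

theorem digraphOne_adj_iff {n r : ℕ} {i j : Fin n} :
    (digraphOne n r).Adj i j ↔ i.val < j.val ∧
      (i.val = 0 ∨ ∃ t : ℕ, t < r ∧ i.val = 2 * t + 1 ∧ j.val = 2 * t + 2) := by
  simp only [digraphOne, graphZero, SimpleGraph.fromRel_adj, Fin.lt_def]
  constructor
  · rintro ⟨⟨-, (h | ⟨t, h1, h2, h3, h4⟩) | (h | ⟨t, h1, h2, h3, h4⟩)⟩, hlt⟩
    · exact ⟨hlt, Or.inl h⟩
    · exact ⟨hlt, Or.inr ⟨t - 1, by omega, by omega, by omega⟩⟩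
    · omega
    · omega
  · rintro ⟨hlt, h⟩
    refine ⟨⟨fun h => by simp [h] at hlt, Or.inl ?_⟩, hlt⟩
    rcases h with h | ⟨t, h1, h2, h3⟩
    · exact Or.inl h
    · exact Or.inr ⟨t + 1, by omega, by omega, by omega, by omega⟩

/-- The arcs not leaving `u` form a matching of size `r`. Label 0 goes to `u`, and labels `2 * i +
1`, `2 * i + 2` go to the tail `t i` and head `h i` of the `i`-th such arc. -/
theorem IsUniversalSource.digraphIso {V : Type*} [Fintype V] {G : SimpleGraph V}
    {D : Digraph V} {u : V} (hu : IsUniversalSource D u) (hG : IsCactus G)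
    (hD : IsOrientation G D) : DigraphIso D (digraphOne (Fintype.card V) (numCycles G)) := by
  classical
  set n := Fintype.card V with hn
  set r := numCycles G with hr
  have hrn : 2 * r + 1 ≤ n := hG.two_mul_numCycles_lt
  set A : Finset (V × V) := Finset.univ.filter fun p => D.Adj p.1 p.2 ∧ p.1 ≠ u with hA
  have hAc : A.card = r := by
    have h0 := hu.outDeg_add_one hD
    have h2 := hD.sum_outDeg_add_inDeg
    have h3 := sum_outDeg_eq_sum_inDeg D
    have h4 := hG.ncard_edgeSet
    rw [Finset.sum_add_distrib] at h2
    have h5 : A.card + outDeg D u = ∑ v, outDeg D v := by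
      rw [← Finset.sum_erase_add _ _ (Finset.mem_univ u), hA, Finset.card_filter,
        Fintype.sum_prod_type, ← Finset.sum_erase_add _ _ (Finset.mem_univ u)]
      have : ∑ y, (if D.Adj (u, y).1 (u, y).2 ∧ (u, y).1 ≠ u then 1 else 0) = 0 := by simp
      rw [this, add_zero]
      congr 1
      refine Finset.sum_congr rfl fun v hv => ?_
      have hvu := Finset.ne_of_mem_erase hv
      rw [outDeg_eq_card, Finset.card_filter]
      simp [hvu]
    omega
  obtain ⟨t, h, ht1, ht2, ht3⟩ : ∃ t h : ℕ → V, (∀ i < r, D.Adj (t i) (h i) ∧ t i ≠ u) ∧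
      (∀ x y, D.Adj x y → x ≠ u → ∃ i < r, t i = x ∧ h i = y) ∧
      (∀ i < r, ∀ j < r, t i = t j → h i = h j → i = j) := by
    let e : Fin r ≃ A := (A.equivFinOfCardEq hAc).symm
    have he : ∀ i : Fin r, D.Adj (e i).1.1 (e i).1.2 ∧ (e i).1.1 ≠ u := fun i =>
      (Finset.mem_filter.1 (e i).2).2
    refine ⟨fun i => if hi : i < r then (e ⟨i, hi⟩).1.1 else u,
      fun i => if hi : i < r then (e ⟨i, hi⟩).1.2 else u, ?_, ?_, ?_⟩
    · intro i hi
      simp only [hi, dif_pos]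
      exact he _
    · intro x y hxy hx
      have hm : (x, y) ∈ A := by
        rw [hA, Finset.mem_filter]
        exact ⟨Finset.mem_univ _, hxy, hx⟩
      obtain ⟨i, hi⟩ := e.surjective ⟨(x, y), hm⟩
      refine ⟨i, i.2, ?_⟩
      simp [hi]
    · intro i hi j hj h1 h2
      simp only [hi, hj, dif_pos] at h1 h2
      have := e.injective (Subtype.ext (Prod.ext h1 h2))
      simpa using this
  have hhu : ∀ i < r, h i ≠ u := by
    intro i hi hhi
    have := ht1 i hi
    rw [hhi] at this
    exact hD.2 _ _ ⟨this.1, hu _ this.2⟩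
  have hadj : ∀ i < r, G.Adj (t i) (h i) := fun i hi => (hD.1 _ _).2 (Or.inl (ht1 i hi).1)
  have htt : ∀ i < r, ∀ j < r, t i = t j → i = j := by
    intro i hi j hj hij
    refine ht3 i hi j hj hij (hu.eq_of_adj_of_adj hG hD (ht1 i hi).2 (hhu i hi) (hhu j hj)
      (hadj i hi) ?_)
    rw [hij]
    exact hadj j hj
  have hhh : ∀ i < r, ∀ j < r, h i = h j → i = j := by
    intro i hi j hj hij
    refine ht3 i hi j hj (hu.eq_of_adj_of_adj hG hD (hhu i hi) (ht1 i hi).2 (ht1 j hj).2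
      (hadj i hi).symm ?_) hij
    rw [hij]
    exact (hadj j hj).symm
  have hth : ∀ i < r, ∀ j < r, t i ≠ h j := by
    intro i hi j hj hij
    have : h i = t j := by
      refine hu.eq_of_adj_of_adj hG hD (ht1 i hi).2 (hhu i hi) (ht1 j hj).2 (hadj i hi) ?_
      rw [hij]
      exact (hadj j hj).symm
    have h1 := (ht1 i hi).1
    have h2 := (ht1 j hj).1
    rw [← this, ← hij] at h2
    exact hD.2 _ _ ⟨h1, h2⟩
  set f : Fin n → V := fun k =>
    if k.val = 0 then u else if k.val % 2 = 1 then t (k.val / 2) else h (k.val / 2 - 1) with hf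
  set s : Finset (Fin n) := Finset.univ.filter fun k => k.val ≤ 2 * r with hs
  have f0 : ∀ k : Fin n, k.val = 0 → f k = u := fun k hk => by simp [hf, hk]
  have f1 : ∀ (k : Fin n) (i : ℕ), k.val = 2 * i + 1 → f k = t i := by
    intro k i hk
    have h1 : (2 * i + 1) % 2 = 1 := by omega
    have h2 : (2 * i + 1) / 2 = i := by omega
    simp [hf, hk, h2]
  have f2 : ∀ (k : Fin n) (i : ℕ), k.val = 2 * i + 2 → f k = h i := by
    intro k i hk
    have h2 : (2 * i + 2) / 2 - 1 = i := by omega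
    simp [hf, hk]
  have hcases : ∀ k ∈ s, k.val = 0 ∨ (∃ i < r, k.val = 2 * i + 1) ∨
      ∃ i < r, k.val = 2 * i + 2 := by
    intro k hk
    simp only [hs, Finset.mem_filter, Finset.mem_univ, true_and] at hk
    rcases Nat.eq_zero_or_pos k.val with h0 | h0
    · exact Or.inl h0
    · rcases Nat.mod_two_eq_zero_or_one k.val with h1 | h1
      · exact Or.inr (Or.inr ⟨k.val / 2 - 1, by omega, by omega⟩)
      · exact Or.inr (Or.inl ⟨k.val / 2, by omega, by omega⟩)
  have hinj : Set.InjOn f s := by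
    intro k hk l hl hkl
    apply Fin.ext
    rcases hcases k hk with hk | ⟨i, hi, hk⟩ | ⟨i, hi, hk⟩ <;>
      rcases hcases l hl with hl | ⟨j, hj, hl⟩ | ⟨j, hj, hl⟩
    · omega
    · rw [f0 k hk, f1 l j hl] at hkl
      exact absurd hkl.symm (ht1 j hj).2
    · rw [f0 k hk, f2 l j hl] at hkl
      exact absurd hkl.symm (hhu j hj)
    · rw [f1 k i hk, f0 l hl] at hkl
      exact absurd hkl (ht1 i hi).2
    · rw [f1 k i hk, f1 l j hl] at hkl
      have := htt i hi j hj hkl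
      omega
    · rw [f1 k i hk, f2 l j hl] at hkl
      exact absurd hkl (hth i hi j hj)
    · rw [f2 k i hk, f0 l hl] at hkl
      exact absurd hkl (hhu i hi)
    · rw [f2 k i hk, f1 l j hl] at hkl
      exact absurd hkl.symm (hth j hj i hi)
    · rw [f2 k i hk, f2 l j hl] at hkl
      have := hhh i hi j hj hkl
      omega
  -- Labels above `2 * r` belong to pendent vertices, whose only arc comes from `u`, so any
  -- bijective extension will do.
  obtain ⟨g, hg⟩ := Finset.exists_equiv_extend_of_card_eq (t := (Finset.univ : Finset V))
    (by rw [Fintype.card_fin, Finset.card_univ]) (Finset.subset_univ (s.image f)) hinj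
  let φ : Fin n ≃ V := g.trans (Equiv.subtypeUnivEquiv Finset.mem_univ)
  have hφ : ∀ k ∈ s, φ k = f k := hg
  have hmem : ∀ k : Fin n, k.val ≤ 2 * r → k ∈ s := fun k hk => by simp [hs, hk]
  have hiff : ∀ i j : Fin n, (digraphOne n r).Adj i j ↔ D.Adj (φ i) (φ j) := by
    intro i j
    rw [digraphOne_adj_iff]
    constructor
    · rintro ⟨hlt, h0 | ⟨k, hk, hi, hj⟩⟩
      · have hiu : φ i = u := by rw [hφ i (hmem i (by omega)), f0 i h0]
        rw [hiu]
        refine hu _ ?_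
        rw [← hiu]
        intro hij
        have := φ.injective hij
        subst this
        omega
      · rw [hφ i (hmem i (by omega)), hφ j (hmem j (by omega)), f1 i k hi, f2 j k hj]
        exact (ht1 k hk).1
    · intro hij
      by_cases hiu : φ i = u
      · have hz : φ ⟨0, by omega⟩ = u := by rw [hφ _ (hmem _ (Nat.zero_le _)), f0 _ rfl]
        have hi0 := φ.injective (hiu.trans hz.symm)
        refine ⟨?_, Or.inl (by rw [hi0])⟩
        rw [hi0]
        rcases Nat.eq_zero_or_pos j.val with h0 | h0
        · exfalso
          have : i = j := Fin.ext (by rw [hi0, h0])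
          subst this
          exact hD.irrefl _ hij
        · exact h0
      · obtain ⟨k, hk, hti, hhj⟩ := ht2 _ _ hij hiu
        have e1 : φ ⟨2 * k + 1, by omega⟩ = t k := by
          rw [hφ _ (hmem _ (by change 2 * k + 1 ≤ _; omega)), f1 _ k rfl]
        have e2 : φ ⟨2 * k + 2, by omega⟩ = h k := by
          rw [hφ _ (hmem _ (by change 2 * k + 2 ≤ _; omega)), f2 _ k rfl]
        have hi := φ.injective (hti.symm.trans e1.symm)
        have hj := φ.injective (hhj.symm.trans e2.symm)
        rw [hi, hj]
        exact ⟨Nat.lt_succ_self _, Or.inr ⟨k, hk, rfl, rfl⟩⟩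
  exact ⟨RelIso.symm ⟨φ, fun {i j} => (hiff i j).symm⟩⟩

/-! ### Equality in the cherry count -/

/-- What equality in the counting of cherries says about the graph. -/
theorem IsCactus.exists_isCherry_of_sum_choose_eq {V : Type*} [Fintype V] {G : SimpleGraph V}
    (hG : IsCactus G) {D : Digraph V} (hD : IsOrientation G D)
    (h : ∑ v, ((outDeg D v).choose 2 + (inDeg D v).choose 2)
      = (Fintype.card V - 1).choose 2 + numCycles G) :
    (∀ x y, x ≠ y → ¬ G.Adj x y → ∃ v, IsCherry D v x y) ∧
      ∀ S ∈ cycleSets G, S.card = 3 ∨ S.card = 4 := by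
  classical
  have h1 := hG.two_mul_sum_choose_add_le hD
  rw [h] at h1
  constructor
  · have h2 : (Finset.univ.filter fun p : V × V =>
        p.1 ≠ p.2 ∧ ¬ G.Adj p.1 p.2 ∧ ∀ v, ¬ IsCherry D v p.1 p.2) = ∅ := by
      rw [← Finset.card_eq_zero]
      omega
    intro x y hxy hn
    by_contra! hv
    have : (x, y) ∈ (∅ : Finset (V × V)) := by
      rw [← h2]
      simpa using ⟨hxy, hn, hv⟩
    simp at this
  · have h2 : ((cycleSets G).filter fun S => S.card ≠ 3 ∧ S.card ≠ 4) = ∅ := by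
      rw [← Finset.card_eq_zero]
      omega
    intro S hS
    by_contra! hc
    have : S ∈ (∅ : Finset (Finset V)) := by
      rw [← h2]
      simpa using ⟨hS, hc⟩
    simp at this

theorem outDeg_pos_iff {V : Type*} [Finite V] {D : Digraph V} {u : V} :
    outDeg D u ≠ 0 ↔ ∃ v, D.Adj u v := by
  rw [outDeg, ne_eq, Set.ncard_eq_zero, ← ne_eq, ← Set.nonempty_iff_ne_empty]
  rfl

theorem inDeg_pos_iff {V : Type*} [Finite V] {D : Digraph V} {u : V} :
    inDeg D u ≠ 0 ↔ ∃ v, D.Adj v u := by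
  rw [inDeg, ne_eq, Set.ncard_eq_zero, ← ne_eq, ← Set.nonempty_iff_ne_empty]
  rfl

theorem IsCactus.exists_isUniversalSource_of_universal {V : Type*} [Fintype V]
    {G : SimpleGraph V} (hG : IsCactus G) {D : Digraph V} (hD : IsOrientation G D)
    (h : ∑ v, ((outDeg D v).choose 2 + (inDeg D v).choose 2)
      = (Fintype.card V - 1).choose 2 + numCycles G)
    {u : V} (hu : ∀ v, v ≠ u → G.Adj u v) :
    ∃ u, IsUniversalSource D u ∨ IsUniversalSource (reverseDigraph D) u := by
  classical
  obtain ⟨hch, -⟩ := hG.exists_isCherry_of_sum_choose_eq hD h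
  by_cases ho : outDeg D u = 0
  · refine ⟨u, Or.inr fun v hv => ?_⟩
    rcases (hD.1 u v).1 (hu v hv) with h' | h'
    · exact absurd ho (outDeg_pos_iff.2 ⟨v, h'⟩)
    · exact h'
  by_cases hi : inDeg D u = 0
  · refine ⟨u, Or.inl fun v hv => ?_⟩
    rcases (hD.1 u v).1 (hu v hv) with h' | h'
    · exact h'
    · exact absurd hi (inDeg_pos_iff.2 ⟨v, h'⟩)
  obtain ⟨y, hy⟩ := outDeg_pos_iff.1 ho
  obtain ⟨x, hx⟩ := inDeg_pos_iff.1 hi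
  have hGo : ∀ {y}, D.Adj u y → G.Adj u y := fun h => (hD.1 _ _).2 (Or.inl h)
  have hGi : ∀ {x}, D.Adj x u → G.Adj u x := fun h => (hD.1 _ _).2 (Or.inr h)
  -- Otherwise `x` and `y` are the ends of a cherry. Its centre is not `u`, so it would be joined to
  -- two vertices besides `u`, against the matching property.
  have key : ∀ x y, D.Adj x u → D.Adj u y → G.Adj x y := by
    intro x y hx hy
    by_contra hn
    have hxy : x ≠ y := by
      rintro rfl
      exact hD.2 _ _ ⟨hx, hy⟩
    obtain ⟨w, hw⟩ := hch x y hxy hn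
    have hwu : w ≠ u := by
      rintro rfl
      rcases hw.2 with h' | h'
      · exact hD.2 _ _ ⟨hx, h'.1⟩
      · exact hD.2 _ _ ⟨hy, h'.2⟩
    exact hxy (hG.eq_of_adj_of_adj (hu w hwu) (hGi hx) (hGo hy) (hD.adj_left hw)
      (hD.adj_right hw))
  have hxy := key x y hx hy
  have hall : (Finset.univ : Finset V) ⊆ {u, x, y} := by
    intro z _
    by_cases hz : z = u
    · simp [hz]
    rcases (hD.1 u z).1 (hu z hz) with h' | h'
    · have := hG.eq_of_adj_of_adj (hGi hx) (hGo hy) (hGo h') hxy (key x z hx h')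
      simp [this]
    · have := hG.eq_of_adj_of_adj (hGo hy) (hGi hx) (hGi h') hxy.symm (key z y h' hy).symm
      simp [this]
  have hc : Fintype.card V ≤ 3 := by
    rw [← Finset.card_univ]
    exact (Finset.card_le_card hall).trans Finset.card_le_three
  -- Only a triangle is left. Equality excludes its cyclic orientation, and the centre of a cherry
  -- is universal; it need not be `u`.
  have hpos : ∑ v, ((outDeg D v).choose 2 + (inDeg D v).choose 2) ≠ 0 := by
    have : ({u, x, y} : Finset V) ∈ cycleSets G :=
      triangle_mem_cycleSets (hGi hx) hxy (hGo hy).symm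
    have h1 := card_cycleSets_le G
    have h2 := Finset.card_pos.2 ⟨_, this⟩
    omega
  obtain ⟨v, -, hv⟩ := Finset.exists_ne_zero_of_sum_ne_zero hpos
  refine ⟨v, ?_⟩
  rcases Nat.lt_or_ge (outDeg D v) 2 with h1 | h1
  · rcases Nat.lt_or_ge (inDeg D v) 2 with h2 | h2
    · rw [Nat.choose_eq_zero_of_lt h1, Nat.choose_eq_zero_of_lt h2] at hv
      exact absurd rfl hv
    · refine Or.inr (hD.reverse.isUniversalSource_of_le ?_)
      change Fintype.card V ≤ inDeg D v + 1
      omega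
  · exact Or.inl (hD.isUniversalSource_of_le (by omega))

/-- Let `w` be a common neighbour of `u` and `x`. A further neighbour `z` of `u` is adjacent to `w`
or `x`, or else a common neighbour of `z` and `x` closes a 5-cycle. So `z` completes a triangle or
4-cycle through the edge `uw`; that edge lies on one cycle only, hence `z` is unique. -/
theorem IsCactus.ncard_neighborSet_le_two {V : Type*} [Fintype V] {G : SimpleGraph V}
    (hG : IsCactus G) (hlen : ∀ S ∈ cycleSets G, S.card = 3 ∨ S.card = 4)
    (hdist : ∀ x y, x ≠ y → ¬ G.Adj x y → ∃ v, G.Adj v x ∧ G.Adj v y) {u x : V} (hxu : x ≠ u)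
    (hn : ¬ G.Adj u x) : (G.neighborSet u).ncard ≤ 2 := by
  classical
  obtain ⟨w, hwu, hwx⟩ := hdist u x hxu.symm hn
  have h1 : ∀ z, G.Adj u z → z ≠ w → G.Adj w z ∨ G.Adj x z := by
    intro z huz hzw
    by_contra! hno
    have hzx : z ≠ x := by
      rintro rfl
      exact hn huz
    obtain ⟨q, hqz, hqx⟩ := hdist z x hzx fun h => hno.2 h.symm
    have hqu : q ≠ u := by
      rintro rfl
      exact hn hqx
    have hqw : q ≠ w := by
      rintro rfl
      exact hno.1 hqz
    have h5 : [u, w, x, q, z].Nodup := by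
      have := hwu.ne
      have := hwx.ne
      have := hqx.ne
      have := hqz.ne
      have := huz.ne
      simp
      grind
    have := hlen _ (fiveCycle_mem_cycleSets hwu.symm hwx hqx.symm hqz huz.symm h5)
    have hcard : ({u, w, x, q, z} : Finset V).card = 5 := by
      simpa using List.toFinset_card_of_nodup h5
    omega
  have h2 : (G.neighborSet u \ {w}).ncard ≤ 1 := by
    rw [Set.ncard_le_one_iff]
    rintro z z' ⟨hz, hzw⟩ ⟨hz', hzw'⟩
    have hz : G.Adj u z := hz
    have hz' : G.Adj u z' := hz'
    have hzw : z ≠ w := hzw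
    have hzw' : z' ≠ w := hzw'
    have four : ∀ z, G.Adj u z → z ≠ w → G.Adj x z → ({u, w, x, z} : Finset V) ∈ cycleSets G :=
      fun z hz hzw hxz => fourCycle_mem_cycleSets hwu.symm hwx hxz hz.symm hxu.symm hzw.symm
    have mixed : ∀ z z', G.Adj u z → G.Adj u z' → z' ≠ w → G.Adj w z → G.Adj x z' → False := by
      intro z z' hz hz' hzw' hwz hxz'
      have := hG.cycleSets_eq (triangle_mem_cycleSets hwu.symm hwz hz.symm)
        (four z' hz' hzw' hxz') hwu.ne (by simp) (by simp) (by simp) (by simp)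
      have hx : x ∈ ({u, w, z} : Finset V) := by
        rw [this]
        simp
      simp only [Finset.mem_insert, Finset.mem_singleton] at hx
      rcases hx with rfl | rfl | rfl
      · exact hxu rfl
      · exact hwx.ne rfl
      · exact hn hz
    rcases h1 z hz hzw with a | a <;> rcases h1 z' hz' hzw' with b | b
    · exact hG.eq_of_adj_of_adj hwu.symm hz hz' a b
    · exact (mixed z z' hz hz' hzw' a b).elim
    · exact (mixed z' z hz' hz hzw b a).elim
    · have := hG.cycleSets_eq (four z hz hzw a) (four z' hz' hzw' b) hwu.ne (by simp) (by simp)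
        (by simp) (by simp)
      have hm : z ∈ ({u, w, x, z'} : Finset V) := by
        rw [← this]
        simp
      simp only [Finset.mem_insert, Finset.mem_singleton] at hm
      rcases hm with rfl | rfl | rfl | h
      · exact absurd rfl hz.ne
      · exact absurd rfl hzw
      · exact absurd hz hn
      · exact h
  have := Set.ncard_sdiff_singleton_add_one (s := G.neighborSet u) (a := w) hwu.symm
  omega

/-- All degrees are at most two, so a vertex is the centre of at most one cherry and `(n - 1).choose
2 + r ≤ n`; with `n ≥ 4` this gives `n = 4` and `r ≤ 1`. The cherries at a vertex number less than
its degree, which gives `r ≥ 1`. Then every vertex is the centre of exactly one cherry. -/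
theorem IsCactus.iso_cycleGraph_four {V : Type*} [Fintype V] {G : SimpleGraph V}
    (hG : IsCactus G) {D : Digraph V} (hD : IsOrientation G D)
    (h : ∑ v, ((outDeg D v).choose 2 + (inDeg D v).choose 2)
      = (Fintype.card V - 1).choose 2 + numCycles G)
    (hu : ∀ u, ∃ v, v ≠ u ∧ ¬ G.Adj u v) :
    Fintype.card V = 4 ∧ numCycles G = 1 ∧ IsSinkSource D ∧ (∀ v, outDeg D v ≤ 2 ∧ inDeg D v ≤ 2)
      ∧ Nonempty (G ≃g SimpleGraph.cycleGraph 4) := by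
  classical
  obtain ⟨hch, hlen⟩ := hG.exists_isCherry_of_sum_choose_eq hD h
  have hdist : ∀ x y, x ≠ y → ¬ G.Adj x y → ∃ v, G.Adj v x ∧ G.Adj v y := fun x y hxy hn =>
    let ⟨v, hv⟩ := hch x y hxy hn
    ⟨v, hD.adj_left hv, hD.adj_right hv⟩
  have hdeg2 : ∀ v, outDeg D v + inDeg D v ≤ 2 := by
    intro v
    obtain ⟨x, hx, hn⟩ := hu v
    rw [hD.outDeg_add_inDeg]
    exact hG.ncard_neighborSet_le_two hlen hdist hx hn
  obtain ⟨u⟩ := hG.1.nonempty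
  obtain ⟨x, hxu, hux⟩ := hu u
  have : Nontrivial V := ⟨x, u, hxu⟩
  have hdeg1 : ∀ v, 1 ≤ outDeg D v + inDeg D v := by
    intro v
    rw [hD.outDeg_add_inDeg, ncard_neighborSet_eq_degree]
    exact hG.1.preconnected.degree_pos_of_nontrivial v
  obtain ⟨w, hwu, hwx⟩ := hdist u x hxu.symm hux
  obtain ⟨y, hyw, hwy⟩ := hu w
  have hyu : y ≠ u := by
    rintro rfl
    exact hwy hwu
  have hyx : y ≠ x := by
    rintro rfl
    exact hwy hwx
  have hnodup : [u, w, x, y].Nodup := by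
    have := hwu.ne
    have := hwx.ne
    simp
    grind
  have hcard4 : ({u, w, x, y} : Finset V).card = 4 := by
    simpa using List.toFinset_card_of_nodup hnodup
  have h4 : 4 ≤ Fintype.card V := by
    rw [← hcard4]
    exact Finset.card_le_univ _
  have hle1 : ∀ v, (outDeg D v).choose 2 + (inDeg D v).choose 2 ≤ 1 := by
    intro v
    have := hdeg2 v
    generalize outDeg D v = p at *
    generalize inDeg D v = q at *
    have : p ≤ 2 := by omega
    have : q ≤ 2 := by omega
    interval_cases p <;> interval_cases q <;> simp_all
  have hle2 : ∀ v, (outDeg D v).choose 2 + (inDeg D v).choose 2 + 1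
      ≤ outDeg D v + inDeg D v := by
    intro v
    have := hdeg2 v
    have := hdeg1 v
    generalize outDeg D v = p at *
    generalize inDeg D v = q at *
    have : p ≤ 2 := by omega
    have : q ≤ 2 := by omega
    interval_cases p <;> interval_cases q <;> simp_all
  have hsum1 : ∑ v, ((outDeg D v).choose 2 + (inDeg D v).choose 2) ≤ Fintype.card V := by
    refine (Finset.sum_le_sum fun v _ => hle1 v).trans ?_
    simp
  have hV : Fintype.card V = 4 := by
    have h2 := two_mul_choose_two (Fintype.card V - 1)
    obtain ⟨k, hk⟩ : ∃ k, Fintype.card V = k + 4 := ⟨Fintype.card V - 4, by omega⟩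
    rw [hk] at h h2 hsum1
    have e1 : k + 4 - 1 = k + 3 := rfl
    have e2 : k + 3 - 1 = k + 2 := rfl
    rw [e1] at h h2
    rw [e2] at h2
    have : (k + 3) * (k + 2) = k * k + 5 * k + 6 := by ring
    have : k = 0 := by omega
    omega
  have hr : numCycles G = 1 := by
    have h1 : ∑ v, ((outDeg D v).choose 2 + (inDeg D v).choose 2) + Fintype.card V
        ≤ ∑ v, (outDeg D v + inDeg D v) := by
      rw [← Finset.card_univ, Finset.card_eq_sum_ones, ← Finset.sum_add_distrib]
      exact Finset.sum_le_sum fun v _ => hle2 v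
    have h2 := hG.ncard_edgeSet
    rw [hD.sum_outDeg_add_inDeg] at h1
    rw [hV] at h h1 h2 hsum1
    have h3 : Nat.choose (4 - 1) 2 = 3 := rfl
    omega
  have heq1 : ∀ v, (outDeg D v).choose 2 + (inDeg D v).choose 2 = 1 := by
    have : ∑ v, ((outDeg D v).choose 2 + (inDeg D v).choose 2) = ∑ _v : V, 1 := by
      rw [h, hr, hV]
      simp [hV]
    exact fun v => (Finset.sum_eq_sum_iff_of_le fun v _ => hle1 v).1 this v (Finset.mem_univ v)
  have hss : ∀ v, (outDeg D v = 0 ∧ inDeg D v = 2) ∨ (outDeg D v = 2 ∧ inDeg D v = 0) := by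
    intro v
    have := hdeg2 v
    have := heq1 v
    generalize outDeg D v = p at *
    generalize inDeg D v = q at *
    have : p ≤ 2 := by omega
    have : q ≤ 2 := by omega
    interval_cases p <;> interval_cases q <;> simp_all
  have hnb : ∀ v, (G.neighborSet v).ncard = 2 := by
    intro v
    rw [← hD.outDeg_add_inDeg]
    rcases hss v with h' | h' <;> omega
  have huniv : ∀ z, z = u ∨ z = w ∨ z = x ∨ z = y := by
    have : ({u, w, x, y} : Finset V) = Finset.univ := by
      rw [← Finset.card_eq_iff_eq_univ, hcard4, hV]
    intro z
    have hz := Finset.mem_univ z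
    rw [← this] at hz
    simpa using hz
  have hlast : ∀ p q, (∀ z, G.Adj p z → z = w ∨ z = q) → G.Adj p q := by
    intro p q hz
    by_contra hn
    have : G.neighborSet p ⊆ {w} := by
      intro z hpz
      rcases hz z hpz with rfl | rfl
      · rfl
      · exact absurd hpz hn
    have := Set.ncard_le_ncard this
    rw [hnb, Set.ncard_singleton] at this
    omega
  have huy : G.Adj u y := by
    refine hlast u y fun z hz => ?_
    rcases huniv z with rfl | rfl | rfl | rfl
    · exact absurd hz (G.loopless.irrefl _)
    · exact Or.inl rfl
    · exact absurd hz hux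
    · exact Or.inr rfl
  have hxy : G.Adj x y := by
    refine hlast x y fun z hz => ?_
    rcases huniv z with rfl | rfl | rfl | rfl
    · exact absurd hz.symm hux
    · exact Or.inl rfl
    · exact absurd hz (G.loopless.irrefl _)
    · exact Or.inr rfl
  have hbij : Function.Bijective ![u, w, x, y] := by
    rw [Fintype.bijective_iff_injective_and_card]
    refine ⟨?_, by simp [hV]⟩
    have : (List.ofFn ![u, w, x, y]).Nodup := by simpa [List.ofFn_succ] using hnodup
    exact List.nodup_ofFn.1 this
  refine ⟨hV, hr, fun v => (hss v).imp And.left And.right, fun v => by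
    rcases hss v with h' | h' <;> omega, ⟨?_⟩⟩
  refine RelIso.symm ⟨Equiv.ofBijective _ hbij, ?_⟩
  have hxu' : ¬ G.Adj x u := fun h => hux h.symm
  have hyw' : ¬ G.Adj y w := fun h => hwy h.symm
  intro i j
  fin_cases i <;> fin_cases j <;>
    simp [SimpleGraph.cycleGraph_adj, hwu, hwu.symm, hwx, hwx.symm, hux, hxu', hwy, hyw', huy,
      huy.symm, hxy, hxy.symm] <;> decide

/-! ### Invariance under isomorphism and the extremal family -/

theorem digraphTwo_adj_iff {n r : ℕ} {i j : Fin n} :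
    (digraphTwo n r).Adj i j ↔ (digraphOne n r).Adj j i := by
  simp only [digraphTwo, digraphOne]
  rw [SimpleGraph.adj_comm]

theorem digraphIso_digraphTwo_iff {V : Type*} {D : Digraph V} {n r : ℕ} :
    DigraphIso D (digraphTwo n r) ↔ DigraphIso (reverseDigraph D) (digraphOne n r) := by
  constructor
  · rintro ⟨e⟩
    exact ⟨⟨e.toEquiv, fun {_ _} => digraphTwo_adj_iff.symm.trans e.map_rel_iff⟩⟩
  · rintro ⟨e⟩
    exact ⟨⟨e.toEquiv, fun {_ _} => digraphTwo_adj_iff.trans e.map_rel_iff⟩⟩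

theorem exists_isUniversalSource_of_digraphIso {V : Type*} {D : Digraph V} {n r : ℕ} (hn : 0 < n)
    (h : DigraphIso D (digraphOne n r)) : ∃ u, IsUniversalSource D u := by
  obtain ⟨e⟩ := h
  refine ⟨e.symm ⟨0, hn⟩, fun v hv => ?_⟩
  rw [← e.map_rel_iff, e.apply_symm_apply, digraphOne_adj_iff]
  refine ⟨Nat.pos_of_ne_zero fun h => hv ?_, Or.inl rfl⟩
  rw [RelIso.eq_symm_apply]
  exact Fin.ext h

theorem outDeg_of_relIso {V W : Type*} {D : Digraph V} {E : Digraph W} (e : D.Adj ≃r E.Adj)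
    (v : V) : outDeg E (e v) = outDeg D v := by
  rw [outDeg, outDeg, ← Set.ncard_image_of_injective _ e.injective]
  congr 1
  ext w
  simp only [Set.mem_image, Set.mem_ofPred_eq]
  constructor
  · intro h
    refine ⟨e.symm w, ?_, e.apply_symm_apply w⟩
    rw [← e.map_rel_iff, e.apply_symm_apply]
    exact h
  · rintro ⟨x, hx, rfl⟩
    exact e.map_rel_iff.2 hx

theorem inDeg_of_relIso {V W : Type*} {D : Digraph V} {E : Digraph W} (e : D.Adj ≃r E.Adj)
    (v : V) : inDeg E (e v) = inDeg D v :=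
  outDeg_of_relIso (D := reverseDigraph D) (E := reverseDigraph E)
    ⟨e.toEquiv, fun {_ _} => e.map_rel_iff⟩ v

/-- Every vertex has out- and in-degree 2 and 0 in some order. The general `F` covers both the
binomial and the excess sum. -/
theorem IsSinkSource.sum_eq_of_relIso {V : Type*} [Fintype V] {D : Digraph V}
    {E : Digraph (Fin 4)} (hE : IsOrientation (SimpleGraph.cycleGraph 4) E) (hs : IsSinkSource E)
    (e : D.Adj ≃r E.Adj) {M : Type*} [AddCommMonoid M] (F : ℕ → M) (h0 : F 0 = 0) :
    ∑ v, (F (outDeg D v) + F (inDeg D v)) = Fintype.card V • F 2 := by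
  classical
  rw [← Finset.card_univ, ← Finset.sum_const]
  refine Finset.sum_congr rfl fun v _ => ?_
  have h1 := hE.outDeg_add_inDeg (e v)
  rw [ncard_neighborSet_eq_degree, SimpleGraph.cycleGraph_degree_three_le, outDeg_of_relIso,
    inDeg_of_relIso] at h1
  have h2 := hs (e v)
  rw [outDeg_of_relIso, inDeg_of_relIso] at h2
  rcases h2 with h2 | h2
  · rw [h2, zero_add] at h1
    rw [h1, h2, h0, zero_add]
  · rw [h2, add_zero] at h1
    rw [h1, h2, h0, add_zero]

theorem powExcess_one_three : powExcess 1 3 = 0 := by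
  have h3 : ((3 : ℕ) : ℝ) ^ ((1 : ℝ) + 1) = 9 := by
    rw [show (1 : ℝ) + 1 = (2 : ℕ) by norm_num, Real.rpow_natCast]
    norm_num
  have h2 : (2 : ℝ) ^ ((1 : ℝ) + 1) = 4 := by
    rw [show (1 : ℝ) + 1 = (2 : ℕ) by norm_num, Real.rpow_natCast]
    norm_num
  rw [powExcess, h3, h2, show Nat.choose 3 2 = 3 from rfl]
  norm_num

theorem IsCactus.isExtremal_of_sum_eq {V : Type*} [Fintype V] {G : SimpleGraph V}
    (hG : IsCactus G) {D : Digraph V} (hD : IsOrientation G D) {a : ℝ} (ha : 1 ≤ a)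
    (h1 : ∑ v, ((outDeg D v).choose 2 + (inDeg D v).choose 2)
      = (Fintype.card V - 1).choose 2 + numCycles G)
    (h2 : ∑ v, (powExcess a (outDeg D v) + powExcess a (inDeg D v))
      = powExcess a (Fintype.card V - 1)) :
    IsExtremal a (Fintype.card V) (numCycles G) D := by
  by_cases hu : ∃ u, ∀ v, v ≠ u → G.Adj u v
  · obtain ⟨u, hu⟩ := hu
    obtain ⟨w, hw | hw⟩ := hG.exists_isUniversalSource_of_universal hD h1 hu
    · exact Or.inl (hw.digraphIso hG hD)
    · exact Or.inr (Or.inl (digraphIso_digraphTwo_iff.2 (hw.digraphIso hG hD.reverse)))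
  · push Not at hu
    obtain ⟨hV, hr, hs, hdeg, ⟨e⟩⟩ := hG.iso_cycleGraph_four hD h1 hu
    -- All degrees are at most two, so the excess sum vanishes, whereas `powExcess a 3` is positive
    -- for `a > 1`.
    have hP : powExcess a 3 = 0 := by
      rw [hV] at h2
      refine h2.symm.trans (Finset.sum_eq_zero fun v _ => ?_)
      rw [powExcess_eq_zero ha (hdeg v).1, powExcess_eq_zero ha (hdeg v).2, add_zero]
    have ha1 : a = 1 := by
      by_contra hne
      exact (powExcess_three_pos (lt_of_le_of_ne ha (Ne.symm hne))).ne' hP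
    let E : Digraph (Fin 4) := ⟨fun i j => D.Adj (e.symm i) (e.symm j)⟩
    let f : D.Adj ≃r E.Adj := ⟨e.toEquiv, fun {v w} => by
      change D.Adj (e.symm (e v)) (e.symm (e w)) ↔ _
      rw [e.symm_apply_apply, e.symm_apply_apply]⟩
    refine Or.inr (Or.inr ⟨ha1, hV, hr, E, ⟨fun i j => ?_, fun i j => hD.2 _ _⟩, fun i => ?_,
      ⟨f⟩⟩)
    · rw [← e.symm.map_adj_iff]
      exact hD.1 _ _
    · obtain ⟨v, rfl⟩ := f.surjective i
      rw [outDeg_of_relIso, inDeg_of_relIso]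
      exact hs v

theorem IsCactus.sum_eq_of_isExtremal {V : Type*} [Fintype V] {G : SimpleGraph V}
    (hG : IsCactus G) {D : Digraph V} (hD : IsOrientation G D) {a : ℝ} (ha : 1 ≤ a)
    (h : IsExtremal a (Fintype.card V) (numCycles G) D) :
    ∑ v, ((outDeg D v).choose 2 + (inDeg D v).choose 2)
        = (Fintype.card V - 1).choose 2 + numCycles G ∧
      ∑ v, (powExcess a (outDeg D v) + powExcess a (inDeg D v))
        = powExcess a (Fintype.card V - 1) := by
  have hpos : 0 < Fintype.card V := Fintype.card_pos_iff.2 hG.1.nonempty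
  rcases h with h | h | ⟨rfl, hV, hr, E, hE, hs, ⟨e⟩⟩
  · obtain ⟨u, hu⟩ := exists_isUniversalSource_of_digraphIso hpos h
    exact ⟨hu.sum_choose_eq hG hD, hu.sum_powExcess_eq hG hD ha⟩
  · obtain ⟨u, hu⟩ := exists_isUniversalSource_of_digraphIso hpos (digraphIso_digraphTwo_iff.1 h)
    rw [← hu.sum_choose_eq hG hD.reverse, ← hu.sum_powExcess_eq hG hD.reverse ha]
    exact ⟨Finset.sum_congr rfl fun v _ => add_comm _ _,
      Finset.sum_congr rfl fun v _ => add_comm _ _⟩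
  · rw [hs.sum_eq_of_relIso hE e (fun x => x.choose 2) rfl,
      hs.sum_eq_of_relIso hE e (powExcess 1) (powExcess_zero le_rfl), hV, hr]
    exact ⟨rfl, by rw [powExcess_two, smul_zero, powExcess_one_three]⟩

end CactusRandic

theorem theorem1 {V : Type*} [Fintype V] (n r : ℕ) (G : SimpleGraph V)
    (hG : CactusRandic.IsCactus G) (hn : Fintype.card V = n) (hr : CactusRandic.numCycles G = r)
    (D : Digraph V) (hD : CactusRandic.IsOrientation G D) (a : ℝ) (ha : 1 ≤ a) :
    CactusRandic.randic (a + 1) D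
        ≤ (1 / 2) * (((n : ℝ) - 1) ^ (a + 1) + (n : ℝ) - 1 + 2 * (r : ℝ) * (2 : ℝ) ^ a) ∧
      (CactusRandic.randic (a + 1) D
          = (1 / 2) * (((n : ℝ) - 1) ^ (a + 1) + (n : ℝ) - 1 + 2 * (r : ℝ) * (2 : ℝ) ^ a) ↔
        CactusRandic.IsExtremal a n r D) := by
  subst hn hr
  obtain ⟨h1, h2⟩ := hG.randic_le hD ha
  exact ⟨h1, h2.trans ⟨fun h => hG.isExtremal_of_sum_eq hD ha h.1 h.2,
    hG.sum_eq_of_isExtremal hD ha⟩⟩
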